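/- Let $F$ be a non-archimedean local field with ring of integers $R$, uniformizer $\pi$, residue field of $q$ elements and residual characteristic $\neq 2$. Let $\psi:F\to\mathbb C^\times$ be an additive character that is trivial on $R$ but not on $\pi^{-1}R$. Let $dx$ be the Haar measure on $F$ with $\int_R dx=1$ and $d^\times\alpha$ the Haar measure on $F^\times$ with $\int_{R^\times}d^\times\alpha=1$. Let $\theta\in R^\times$ be a non-square (the non-split case). Let $J$ be the $5\times5$ matrix with $1$'s on the antidiagonal and $0$'s elsewhere, and let $K=\{k\in SL(5,R):{}^tkJk=J\}$, acting on column vectors in $F^5$. For $x_1,x_2,x_3\in F$ and $\alpha\in F^\times$ put $$n(x_1,x_2,x_3)=\begin{pmatrix}1&-x_3&-x_2&-x_1&-x_1x_3-\tfrac12x_2^2\\0&1&0&0&x_1\\0&0&1&0&x_2\\0&0&0&1&x_3\\0&0&0&0&1\end{pmatrix},\qquad \gamma_0=\begin{pmatrix}1&1&0&0&0\\-1&0&0&0&0\\0&0&1&0&0\\0&0&0&1&-1\\0&0&0&1&0\end{pmatrix},$$ $a_\alpha=\mathrm{diag}(\alpha,1,1,1,\alpha^{-1})$, $v_0={}^t(0,2\theta,0,1,0)$,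 $v_1=\gamma_0v_0={}^t(2\theta,0,0,1,1)$ and $d_i=a_{\pi^i}$. Let $\phi_i$ be the characteristic function of the orbit $Kd_iv_1$ and $\Phi_r=\sum_{i=0}^r\phi_i$. Define $$\Psi(\alpha,\Phi_r)=\int_F\int_F\int_F\Phi_r\bigl(n(x_1,x_2,x_3)\,a_\alpha\gamma_0v_0\bigr)\,\psi(x_1+2\theta x_3)\,dx_1\,dx_2\,dx_3 .$$ Proposition 3.6. Let $r\ge 1$ and let $\chi:F^\times\to\mathbb C^\times$ be a continuous character. Then the integral defining $\Psi(\alpha,\Phi_r)$ converges absolutely for every $\alpha\in F^\times$, the Mellin transform $$\widehat\Psi_r(\chi)=\int_{F^\times}\Psi(\alpha,\Phi_r)\,\chi(\alpha)\,d^\times\alpha$$ converges absolutely, and $$\widehat\Psi_r(\chi)=X^{-r}-qX^{1-r}\quad\text{with } X=\chi(\pi)^{-1}$$ if $\chi$ is unramified (trivial on $R^\times$), while $\widehat\Psi_r(\chi)=0$ if $\chi$ is ramified (not trivial on $R^\times$). -/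

import Mathlib

open MeasureTheory ValuativeRel
open scoped Matrix Valued

namespace SOFive

/-- The antidiagonal matrix `J` with ones on the antidiagonal. -/
def J (A : Type*) [CommRing A] : Matrix (Fin 5) (Fin 5) A :=
  !![0, 0, 0, 0, 1;
     0, 0, 0, 1, 0;
     0, 0, 1, 0, 0;
     0, 1, 0, 0, 0;
     1, 0, 0, 0, 0]

/-- The split special orthogonal group `SO(3,2; A) = {g ∈ SL(5, A) : ᵗg J g = J}`. -/
def SO32 (A : Type*) [CommRing A] : Subgroup (Matrix.SpecialLinearGroup (Fin 5) A) where
  carrier := {g | (g : Matrix (Fin 5) (Fin 5) A)ᵀ * J A * (g : Matrix (Fin 5) (Fin 5) A) = J A}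
  one_mem' := by simp
  mul_mem' := by
    intro a b ha hb
    simp only [Set.mem_ofPred_eq, Matrix.SpecialLinearGroup.coe_mul, Matrix.transpose_mul] at *
    calc _ = (b : Matrix (Fin 5) (Fin 5) A)ᵀ *
          ((a : Matrix (Fin 5) (Fin 5) A)ᵀ * J A * (a : Matrix (Fin 5) (Fin 5) A)) *
          (b : Matrix (Fin 5) (Fin 5) A) := by simp only [Matrix.mul_assoc]
      _ = J A := by rw [ha, hb]
  inv_mem' := by
    intro a ha
    simp only [Set.mem_ofPred_eq] at *
    have h1 : (a : Matrix (Fin 5) (Fin 5) A) * ((a⁻¹ : Matrix.SpecialLinearGroup (Fin 5) A) :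
        Matrix (Fin 5) (Fin 5) A) = 1 := by
      rw [← Matrix.SpecialLinearGroup.coe_mul, mul_inv_cancel, Matrix.SpecialLinearGroup.coe_one]
    have h2 : ((a⁻¹ : Matrix.SpecialLinearGroup (Fin 5) A) : Matrix (Fin 5) (Fin 5) A)ᵀ *
        (a : Matrix (Fin 5) (Fin 5) A)ᵀ = 1 := by
      rw [← Matrix.transpose_mul, h1, Matrix.transpose_one]
    conv_lhs => rw [← ha]
    simp only [Matrix.mul_assoc, h1, Matrix.mul_one]
    simp only [← Matrix.mul_assoc, h2, Matrix.one_mul]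

section Field

variable {F : Type*} [Field F]

/-- The element `n(x₁, x₂, x₃)` of the unipotent radical `N ≅ F³`. -/
def nMat (x₁ x₂ x₃ : F) : Matrix (Fin 5) (Fin 5) F :=
  !![1, -x₃, -x₂, -x₁, -x₁ * x₃ - x₂ ^ 2 / 2;
     0, 1, 0, 0, x₁;
     0, 0, 1, 0, x₂;
     0, 0, 0, 1, x₃;
     0, 0, 0, 0, 1]

/-- The element `a_α = diag(α, 1, 1, 1, α⁻¹)`. -/
def aMat (α : Fˣ) : Matrix (Fin 5) (Fin 5) F :=
  Matrix.diagonal ![(α : F), 1, 1, 1, ((α⁻¹ : Fˣ) : F)]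

/-- The representative `γ₀` in the non-split case. -/
def γ₀ (F : Type*) [Field F] : Matrix (Fin 5) (Fin 5) F :=
  !![1, 1, 0, 0, 0;
     -1, 0, 0, 0, 0;
     0, 0, 1, 0, 0;
     0, 0, 0, 1, -1;
     0, 0, 0, 1, 0]

/-- The base point `v₀` in the non-split case. -/
def v₀ (θ : F) : Fin 5 → F := ![0, 2 * θ, 0, 1, 0]

/-- The vector `v₁` in the non-split case; it is equal to `γ₀ v₀`. -/
def v₁ (θ : F) : Fin 5 → F := ![2 * θ, 0, 0, 1, 1]

/-- The orbital integral `Ψ(α, φ) = ∫_N φ(n a_α γ₀ v₀) ψ_N(n) dn` with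
`ψ_N(n(x₁, x₂, x₃)) = ψ(x₁ + 2 θ x₃)` and `dn = dx₁ dx₂ dx₃`. -/
noncomputable def orbInt [MeasurableSpace F] (μ : Measure F) (ψ : AddChar F ℂ) (θ : F)
    (φ : (Fin 5 → F) → ℂ) (α : Fˣ) : ℂ :=
  ∫ x : F × F × F, φ ((nMat x.1 x.2.1 x.2.2 * aMat α * γ₀ F) *ᵥ v₀ θ) *
    ψ (x.1 + 2 * θ * x.2.2) ∂(μ.prod (μ.prod μ))

end Field

section LocalField

variable {F : Type*} [Field F] [ValuativeRel F]

/-- `ϖ` is a generator of the maximal ideal of the ring of integers. -/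
def IsUniformizer (ϖ : Fˣ) : Prop :=
  ∃ p : 𝒪[F], (p : F) = ϖ ∧ 𝓂[F] = Ideal.span {p}

/-- The unit group `R^×` of the ring of integers `R`, as a set of elements of `F^×`. -/
def integerUnits (F : Type*) [Field F] [ValuativeRel F] : Set Fˣ :=
  {u | valuation F (u : F) = 1}

/-- `ψ` has conductor `R`: it is trivial on `R` but not on `ϖ⁻¹ R`. -/
def HasConductorIntegers (ψ : AddChar F ℂ) (ϖ : Fˣ) : Prop :=
  (∀ x : F, x ∈ 𝒪[F] → ψ x = 1) ∧ ∃ x : F, x ∈ 𝒪[F] ∧ ψ (((ϖ⁻¹ : Fˣ) : F) * x) ≠ 1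

/-- `χ` is unramified: it is trivial on `R^×`. -/
def IsUnramified (χ : Fˣ →* ℂˣ) : Prop := ∀ u ∈ integerUnits F, χ u = 1

/-- The orbit `K v`, where `K = SO(3,2; R)`. -/
def orbitK (v : Fin 5 → F) : Set (Fin 5 → F) :=
  {w | ∃ k ∈ SO32 𝒪[F], w = (k : Matrix (Fin 5) (Fin 5) 𝒪[F]).map (algebraMap 𝒪[F] F) *ᵥ v}

/-- The characteristic function `φ_r` of the orbit `K d_r v₁`, where
`d_r = diag(ϖ ^ r, 1, 1, 1, ϖ ^ (-r))`. -/
noncomputable def φ (ϖ : Fˣ) (θ : F) (r : ℕ) : (Fin 5 → F) → ℂ :=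
  (orbitK (aMat (ϖ ^ r) *ᵥ v₁ θ)).indicator 1

/-- `Φ_r = φ_0 + φ_1 + ⋯ + φ_r`. -/
noncomputable def Φ (ϖ : Fˣ) (θ : F) (r : ℕ) : (Fin 5 → F) → ℂ :=
  ∑ i ∈ Finset.range (r + 1), φ ϖ θ i

end LocalField

end SOFive

/-! Every vector n a_α γ₀ v₀ lies on the quadric Q = 4θ, where Q(v) = ᵗvJv. By Witt's theorem for
primitive vectors over R, the orbit K d_i v₁ is the sphere |w| = |ϖ|^(-i) of the max norm on this
quadric. Since 4θ is a unit, no vector of the quadric has norm below 1, so there Φ_r is the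
indicator of the ball |w| ≤ |ϖ|^(-r) (`mem_orbitK_iff`, `Φ_eq_indicator`).

Put b = α ϖ^(-r) and y = x₃ + α. The orbital integral vanishes for |b| < 1 and is otherwise ψ(-2θα)
times an integral over `region`. If |b| = 1, the region is R³ and the value is 1. If |b| > 1,
integrating over x₁ kills the part |y| < |b|; on |y| = |b| the substitution x₂ = yz, with Jacobian
|b|, leaves for each z in R the integral of ψ((2θ - z²/2)y + 2θα²/y) over the sphere. As θ is a
non-square, Hensel's lemma makes 2θ - z²/2 a unit, and the sphere integral is -1 for |b| = q and 0
for |b| > q.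

Hence Ψ is 1 on ϖ^r R^×, -q on ϖ^(r-1) R^× and 0 elsewhere (`integral_region_eq`, `orbInt_Φ_eq`).
Integrating against χ gives χ(ϖ)^r - q χ(ϖ)^(r-1) in the unramified case, and 0 on each coset of R^×
in the ramified case. -/

namespace SOFive

/-! ### Topology of the local field -/

section Topology

variable (F : Type*) [Field F] [ValuativeRel F] [TopologicalSpace F] [IsNonarchimedeanLocalField F]

theorem t2Space : T2Space F := by
  let := IsTopologicalAddGroup.rightUniformSpace F
  have := isUniformAddGroup_of_addCommGroup (G := F)
  exact inferInstance

/-- A rank one valuation makes F a proper normed field, hence second countable. This makes closed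
subsets of F × F × F measurable for the product σ-algebra. -/
theorem secondCountableTopology : SecondCountableTopology F := by
  let := IsTopologicalAddGroup.rightUniformSpace F
  have := isUniformAddGroup_of_addCommGroup (G := F)
  let : (Valued.v (R := F)).RankOne :=
  { hom' := IsRankLeOne.nonempty.some.emb (R := F).comp MonoidWithZeroHom.ValueGroup₀.embedding
    strictMono' := IsRankLeOne.nonempty.some.strictMono.comp
        MonoidWithZeroHom.ValueGroup₀.embedding_strictMono }
  open scoped Valued in
  have : ProperSpace F := .of_nontriviallyNormedField_of_weaklyLocallyCompactSpace F
  exact secondCountable_of_proper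

theorem henselianLocalRing : HenselianLocalRing 𝒪[F] := by
  let := IsTopologicalAddGroup.rightUniformSpace F
  have := isUniformAddGroup_of_addCommGroup (G := F)
  have : HenselianRing (valuation F).integer
    (IsLocalRing.maximalIdeal (valuation F).integer) := inferInstance
  refine ⟨fun f hf a₀ h1 h2 => this.is_henselian f hf a₀ h1 (h2.map _)⟩

variable {F}

theorem isClopen_setOf_valuation_le {b : F} (hb : b ≠ 0) :
    IsClopen {x : F | valuation F x ≤ valuation F b} := by
  simp_rw [← (valuation F).restrict_le_iff]
  exact Valuation.isClopen_closedBall (by simpa using hb)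

theorem isClopen_setOf_valuation_eq {b : F} (hb : b ≠ 0) :
    IsClopen {x : F | valuation F x = valuation F b} := by
  have h := Valuation.isClopen_sphere (v := valuation F) (r := (valuation F).restrict b)
    (by simpa using hb)
  convert h using 2
  ext x
  simp [le_antisymm_iff, (valuation F).restrict_le_iff]

theorem isCompact_setOf_valuation_le (b : F) :
    IsCompact {x : F | valuation F x ≤ valuation F b} :=
  IsNonarchimedeanLocalField.isCompact_closedBall F _

theorem isCompact_setOf_valuation_eq {b : F} (hb : b ≠ 0) :
    IsCompact {x : F | valuation F x = valuation F b} :=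
  (isCompact_setOf_valuation_le b).of_isClosed_subset (isClopen_setOf_valuation_eq hb).1
    fun _ hx => le_of_eq hx

end Topology

/-! ### Discreteness of the valuation -/

section Uniformizer

variable {F : Type*} [Field F] [ValuativeRel F] {ϖ : Fˣ}

theorem mem_maximalIdeal_integer_iff (x : 𝒪[F]) : x ∈ 𝓂[F] ↔ valuation F (x : F) < 1 := by
  rw [IsLocalRing.mem_maximalIdeal, mem_nonunits_iff,
    (Valuation.integer.integers (valuation F)).isUnit_iff_valuation_eq_one]
  exact ⟨fun h => lt_of_le_of_ne x.2 h, fun h => h.ne⟩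

theorem isUnit_integer_iff (x : 𝒪[F]) : IsUnit x ↔ valuation F (x : F) = 1 :=
  (Valuation.integer.integers (valuation F)).isUnit_iff_valuation_eq_one

theorem IsUniformizer.valuation_lt_one (h : IsUniformizer ϖ) : valuation F (ϖ : F) < 1 := by
  obtain ⟨p, hp, hm⟩ := h
  rw [← hp, ← mem_maximalIdeal_integer_iff, hm]
  exact Ideal.mem_span_singleton_self p

theorem IsUniformizer.le_of_lt_one (h : IsUniformizer ϖ) {x : F} (hx : valuation F x < 1) :
    valuation F x ≤ valuation F (ϖ : F) := by
  obtain ⟨p, hp, hm⟩ := h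
  have : (⟨x, hx.le⟩ : 𝒪[F]) ∈ 𝓂[F] := (mem_maximalIdeal_integer_iff _).2 hx
  rw [hm, Ideal.mem_span_singleton] at this
  obtain ⟨y, hy⟩ := this
  have hxy : x = p * (y : F) := congrArg Subtype.val hy
  rw [hxy, map_mul, hp]
  exact mul_le_of_le_one_right' y.2

/-- A strict inequality gains a factor |ϖ|. This is the room needed for translations by ϖ⁻¹R in the
vanishing arguments. -/
theorem IsUniformizer.le_mul_of_lt (h : IsUniformizer ϖ) {x y : F}
    (hxy : valuation F x < valuation F y) :
    valuation F x ≤ valuation F (ϖ : F) * valuation F y := by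
  have hy : valuation F y ≠ 0 := (zero_le.trans_lt hxy).ne'
  have h1 : valuation F (x / y) < 1 := by
    rw [map_div₀]
    exact (div_lt_one₀ (zero_lt_iff.2 hy)).2 hxy
  have := h.le_of_lt_one h1
  rwa [map_div₀, div_le_iff₀ (zero_lt_iff.2 hy)] at this

/-- Every nonzero element of the unit ball has the valuation of a power of the uniformizer. -/
theorem IsUniformizer.exists_valuation_eq_pow [IsDiscreteValuationRing 𝒪[F]]
    (h : IsUniformizer ϖ) {x : F} (hx : valuation F x ≤ 1) (hx0 : x ≠ 0) :
    ∃ n : ℕ, valuation F x = valuation F (ϖ : F) ^ n := by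
  obtain ⟨p, hp, hm⟩ := h
  have hp' : Irreducible p := (IsDiscreteValuationRing.irreducible_iff_uniformizer p).2 hm
  obtain ⟨n, u, hu⟩ := IsDiscreteValuationRing.eq_unit_mul_pow_irreducible
    (x := (⟨x, hx⟩ : 𝒪[F])) (by simpa [Subtype.ext_iff] using hx0) hp'
  refine ⟨n, ?_⟩
  have hxu : x = (u : 𝒪[F]) * (p : F) ^ n := congrArg Subtype.val hu
  rw [hxu, map_mul, map_pow, hp, (isUnit_integer_iff (u : 𝒪[F])).1 u.isUnit, one_mul]

end Uniformizer

/-! ### Odd residual characteristic and Hensel's lemma -/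

section Residue

variable {F : Type*} [Field F] [ValuativeRel F]

theorem valuation_two (hchar : ringChar 𝓀[F] ≠ 2) : valuation F (2 : F) = 1 := by
  have h2 : ((2 : 𝒪[F]) : F) = 2 := rfl
  rw [← h2, ← isUnit_integer_iff]
  by_contra h
  have h' : (2 : 𝒪[F]) ∈ 𝓂[F] := (IsLocalRing.mem_maximalIdeal _).2 h
  rw [← IsLocalRing.residue_eq_zero_iff, map_ofNat] at h'
  exact Ring.two_ne_zero hchar h'

/-- A quadratic form value `2θ - z²/2` is a unit when `θ` is a non-square unit. -/
theorem valuation_two_mul_sub [TopologicalSpace F] [IsNonarchimedeanLocalField F]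
    (hchar : ringChar 𝓀[F] ≠ 2) {θ : F} (hθ : valuation F θ = 1) (hθ' : ¬ IsSquare θ)
    {z : F} (hz : valuation F z ≤ 1) : valuation F (2 * θ - z ^ 2 / 2) = 1 := by
  have h2 := valuation_two hchar
  have h20 : (2 : F) ≠ 0 := by
    intro h; rw [h, map_zero] at h2; exact zero_ne_one h2
  have hle : valuation F (2 * θ - z ^ 2 / 2) ≤ 1 := by
    refine (valuation F).map_sub_le ?_ ?_
    · rw [map_mul, h2, hθ, one_mul]
    · rw [map_div₀, h2, div_one, map_pow]
      exact pow_le_one₀ zero_le hz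
  refine le_antisymm hle (not_lt.1 fun hlt => hθ' ?_)
  -- If the value were not a unit, then (z/2)² ≡ θ modulo the maximal ideal. Then z/2 is a unit and
  -- a simple root of X² - θ in the residue field, and it lifts to a square root of θ.
  have := henselianLocalRing F
  have hw : valuation F (z / 2) ≤ 1 := by rw [map_div₀, h2, div_one]; exact hz
  have hlt' : valuation F ((z / 2) ^ 2 - θ) < 1 := by
    have : (z / 2) ^ 2 - θ = -((2 * θ - z ^ 2 / 2) / 2) := by field_simp; ring
    rwa [this, Valuation.map_neg, map_div₀, h2, div_one]
  have hw1 : valuation F (z / 2) = 1 := by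
    have h3 : valuation F ((z / 2) ^ 2) = 1 := by
      rw [← hθ]
      refine (valuation F).map_eq_of_sub_lt ?_
      rwa [hθ]
    rw [map_pow] at h3
    exact (pow_eq_one_iff_of_nonneg zero_le two_ne_zero).1 h3
  obtain ⟨a, ha, -⟩ := HenselianLocalRing.is_henselian
    (Polynomial.X ^ 2 - Polynomial.C (⟨θ, hθ.le⟩ : 𝒪[F]))
    (Polynomial.monic_X_pow_sub_C _ two_ne_zero) ⟨z / 2, hw⟩
    (by
      rw [mem_maximalIdeal_integer_iff]
      simpa using hlt')
    (by
      rw [isUnit_integer_iff]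
      simp [hw1]
      rwa [one_add_one_eq_two])
  refine ⟨a, ?_⟩
  have h4 := congrArg Subtype.val ha
  simp only [Polynomial.eval_sub, Polynomial.eval_pow, Polynomial.eval_X, Polynomial.eval_C] at h4
  have h5 : (a : F) ^ 2 - θ = 0 := h4
  linear_combination -h5

end Residue

/-! ### Orbits of SO(3,2) on primitive vectors over a local ring -/

section Orbit

variable {A : Type*} [CommRing A]

/-- The quadratic form `ᵗv J v`. -/
def quadForm (v : Fin 5 → A) : A := v ⬝ᵥ (J A *ᵥ v)

theorem quadForm_eq (v : Fin 5 → A) :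
    quadForm v = 2 * v 0 * v 4 + 2 * v 1 * v 3 + v 2 ^ 2 := by
  simp [quadForm, J, dotProduct, Matrix.mulVec, Fin.sum_univ_five]
  ring

theorem quadForm_mulVec {g : Matrix (Fin 5) (Fin 5) A} (hg : gᵀ * J A * g = J A)
    (v : Fin 5 → A) : quadForm (g *ᵥ v) = quadForm v := by
  unfold quadForm
  conv_rhs => rw [← hg]
  rw [← Matrix.mulVec_mulVec, ← Matrix.mulVec_mulVec, Matrix.dotProduct_mulVec v gᵀ,
    Matrix.vecMul_transpose]

/-- Two vectors are related when an element of `SO(3,2; A)` carries the first to the second. -/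
def SORel (v w : Fin 5 → A) : Prop := ∃ k ∈ SO32 A, w = (k : Matrix (Fin 5) (Fin 5) A) *ᵥ v

theorem SORel.trans {u v w : Fin 5 → A} (h₁ : SORel u v) (h₂ : SORel v w) : SORel u w := by
  obtain ⟨k, hk, rfl⟩ := h₁
  obtain ⟨l, hl, rfl⟩ := h₂
  exact ⟨l * k, mul_mem hl hk, by simp [Matrix.mulVec_mulVec]⟩

theorem SORel.symm {u v : Fin 5 → A} (h : SORel u v) : SORel v u := by
  obtain ⟨k, hk, rfl⟩ := h
  refine ⟨k⁻¹, inv_mem hk, ?_⟩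
  rw [Matrix.mulVec_mulVec, ← Matrix.SpecialLinearGroup.coe_mul, inv_mul_cancel]
  simp

theorem SORel.of_matrix {g : Matrix (Fin 5) (Fin 5) A} (hdet : g.det = 1)
    (hg : gᵀ * J A * g = J A) (v : Fin 5 → A) : SORel v (g *ᵥ v) :=
  ⟨⟨g, hdet⟩, hg, rfl⟩

theorem SORel.quadForm_eq {u v : Fin 5 → A} (h : SORel u v) : quadForm v = quadForm u := by
  obtain ⟨k, hk, rfl⟩ := h
  exact quadForm_mulVec hk u

theorem sorel_swap_outer (v : Fin 5 → A) : SORel v ![v 4, v 3, v 2, v 1, v 0] := by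
  convert SORel.of_matrix (g := J A) ?_ ?_ v using 1
  · ext i; fin_cases i <;> simp [J, Matrix.mulVec, dotProduct, Fin.sum_univ_five]
  · simp [J, Matrix.det_succ_row_zero, Fin.sum_univ_succ, Fin.succAbove]
    ring
  · ext i j; fin_cases i <;> fin_cases j <;> simp [J, Matrix.mul_apply, Fin.sum_univ_five]

theorem sorel_swap_inner (v : Fin 5 → A) : SORel v ![v 1, v 0, v 2, v 4, v 3] := by
  convert SORel.of_matrix (g := (!![0, 1, 0, 0, 0; 1, 0, 0, 0, 0; 0, 0, 1, 0, 0; 0, 0, 0, 0, 1;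
    0, 0, 0, 1, 0] : Matrix (Fin 5) (Fin 5) A)) ?_ ?_ v using 1
  · ext i; fin_cases i <;> simp [Matrix.mulVec, dotProduct, Fin.sum_univ_five]
  · simp [Matrix.det_succ_row_zero, Fin.sum_univ_succ, Fin.succAbove]
  · ext i j; fin_cases i <;> fin_cases j <;> simp [J, Matrix.mul_apply, Fin.sum_univ_five]

theorem sorel_torus (u : Aˣ) (v : Fin 5 → A) :
    SORel v ![u * v 0, v 1, v 2, v 3, ((u⁻¹ : Aˣ) : A) * v 4] := by
  convert SORel.of_matrix (g := (!![(u : A), 0, 0, 0, 0; 0, 1, 0, 0, 0; 0, 0, 1, 0, 0;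
    0, 0, 0, 1, 0; 0, 0, 0, 0, ((u⁻¹ : Aˣ) : A)] : Matrix (Fin 5) (Fin 5) A)) ?_ ?_ v using 1
  · ext i; fin_cases i <;> simp [Matrix.mulVec, dotProduct, Fin.sum_univ_five]
  · simp [Matrix.det_succ_row_zero, Fin.sum_univ_succ, Fin.succAbove]
  · ext i j; fin_cases i <;> fin_cases j <;> simp [J, Matrix.mul_apply, Fin.sum_univ_five]

/-- `hc` is the condition for the matrix to preserve J, written without dividing by 2 so that it
makes sense over any A. -/
theorem sorel_unipotent {x y z c : A} (hc : 2 * c = -2 * x * z - y ^ 2) (v : Fin 5 → A) :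
    SORel v ![v 0 - z * v 1 - y * v 2 - x * v 3 + c * v 4, v 1 + x * v 4, v 2 + y * v 4,
      v 3 + z * v 4, v 4] := by
  convert SORel.of_matrix (g := (!![1, -z, -y, -x, c; 0, 1, 0, 0, x; 0, 0, 1, 0, y;
    0, 0, 0, 1, z; 0, 0, 0, 0, 1] : Matrix (Fin 5) (Fin 5) A)) ?_ ?_ v using 1
  · ext i; fin_cases i <;> simp [Matrix.mulVec, dotProduct, Fin.sum_univ_five]; ring
  · simp [Matrix.det_succ_row_zero, Fin.sum_univ_succ, Fin.succAbove]
  · ext i j; fin_cases i <;> fin_cases j <;> simp [J, Matrix.mul_apply, Fin.sum_univ_five]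
    linear_combination hc

/-- Witt's theorem for primitive vectors: a vector with a unit coordinate can be moved to one with
last coordinate `1` and prescribed middle coordinates. -/
theorem exists_sorel_last_one [IsLocalRing A] (h2 : IsUnit (2 : A)) {v : Fin 5 → A}
    (hv : ∃ i, IsUnit (v i)) (b₁ b₂ b₃ : A) : ∃ t, SORel v ![t, b₁, b₂, b₃, 1] := by
  obtain ⟨h, hh⟩ := h2.exists_right_inv
  have key4 : ∀ {v : Fin 5 → A}, IsUnit (v 4) → ∃ t, SORel v ![t, b₁, b₂, b₃, 1] := by
    rintro v ⟨u, hu⟩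
    have last : ∀ w : Fin 5 → A, SORel v w → w 1 = b₁ → w 2 = b₂ → w 3 = b₃ → w 4 = 1 →
        ∃ t, SORel v ![t, b₁, b₂, b₃, 1] := by
      rintro w hw rfl rfl rfl h4
      refine ⟨w 0, ?_⟩
      convert hw using 1
      ext i
      fin_cases i <;> simp [h4]
    -- The torus scales the last coordinate to 1; the unipotent element then adds arbitrary amounts
    -- to the middle coordinates. Here h is 1/2.
    refine last _ ((sorel_torus u v).trans <| sorel_unipotent (x := b₁ - v 1) (y := b₂ - v 2)
      (z := b₃ - v 3) (c := h * (-2 * (b₁ - v 1) * (b₃ - v 3) - (b₂ - v 2) ^ 2))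
      (by linear_combination (-2 * (b₁ - v 1) * (b₃ - v 3) - (b₂ - v 2) ^ 2) * hh) _)
      ?_ ?_ ?_ ?_ <;> simp [← hu]
  have key0 : ∀ {v : Fin 5 → A}, IsUnit (v 0) → ∃ t, SORel v ![t, b₁, b₂, b₃, 1] := by
    intro v hv
    obtain ⟨t, ht⟩ := key4 (v := ![v 4, v 3, v 2, v 1, v 0]) (by simpa using hv)
    exact ⟨t, (sorel_swap_outer v).trans ht⟩
  by_cases h0 : IsUnit (v 0)
  · exact key0 h0
  by_cases h4 : IsUnit (v 4)
  · exact key4 h4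
  by_cases h1 : IsUnit (v 1)
  · obtain ⟨t, ht⟩ := key0 (v := ![v 1, v 0, v 2, v 4, v 3]) (by simpa using h1)
    exact ⟨t, (sorel_swap_inner v).trans ht⟩
  by_cases h3 : IsUnit (v 3)
  · obtain ⟨t, ht⟩ := key4 (v := ![v 1, v 0, v 2, v 4, v 3]) (by simpa using h3)
    exact ⟨t, (sorel_swap_inner v).trans ht⟩
  have hu2 : IsUnit (v 2) := by
    obtain ⟨i, hi⟩ := hv
    fin_cases i
    exacts [absurd hi h0, absurd hi h1, hi, absurd hi h3, absurd hi h4]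
  -- Only the middle coordinate is a unit. This element subtracts it from coordinate 0, which
  -- becomes a unit because `v 0` and `v 4` lie in the maximal ideal.
  have hn := sorel_unipotent (x := 0) (y := 1) (z := 0) (c := -h) (by linear_combination -hh) v
  have hu : IsUnit (v 0 - v 2 + -h * v 4) := by
    by_contra hcon
    rw [← mem_nonunits_iff, ← IsLocalRing.mem_maximalIdeal] at h0 h4 hcon
    refine (IsLocalRing.mem_maximalIdeal _).1 ?_ hu2
    have := sub_mem (add_mem h0 (Ideal.mul_mem_left _ (-h) h4)) hcon
    convert this using 1
    ring
  obtain ⟨t, ht⟩ := key0 (v := _) (show IsUnit (![v 0 - 0 * v 1 - 1 * v 2 - 0 * v 3 + -h * v 4,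
    v 1 + 0 * v 4, v 2 + 1 * v 4, v 3 + 0 * v 4, v 4] 0) by simpa using hu)
  exact ⟨t, hn.trans ht⟩

/-- Primitive vectors with the same value of the quadratic form are in the same orbit. -/
theorem sorel_of_quadForm_eq [IsLocalRing A] (h2 : IsUnit (2 : A)) {v w : Fin 5 → A}
    (hv : ∃ i, IsUnit (v i)) (hw : ∃ i, IsUnit (w i)) (hq : quadForm v = quadForm w) :
    SORel v w := by
  -- The normal form (t, 0, 0, 0, 1) has Q = 2t, and 2 is a unit, so Q determines t.
  obtain ⟨t, ht⟩ := exists_sorel_last_one h2 hv 0 0 0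
  obtain ⟨s, hs⟩ := exists_sorel_last_one h2 hw 0 0 0
  have h1 := ht.quadForm_eq
  have h3 := hs.quadForm_eq
  rw [hq, ← h3, quadForm_eq, quadForm_eq] at h1
  simp at h1
  have : t = s := h2.mul_left_cancel h1
  subst this
  exact ht.trans hs.symm

end Orbit

section Orbit

variable {A : Type*} [CommRing A]

theorem SORel.exists_isUnit [IsLocalRing A] {u v : Fin 5 → A} (h : SORel u v)
    (hu : ∃ i, IsUnit (u i)) : ∃ i, IsUnit (v i) := by
  obtain ⟨k, -, rfl⟩ := h.symm
  by_contra! hcon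
  obtain ⟨i, hi⟩ := hu
  refine (IsLocalRing.mem_maximalIdeal _).1 ?_ hi
  exact Ideal.sum_mem (IsLocalRing.maximalIdeal A) fun j (_ : j ∈ Finset.univ) =>
    Ideal.mul_mem_left _ ((k : Matrix (Fin 5) (Fin 5) A) i j)
      ((IsLocalRing.mem_maximalIdeal _).2 (hcon j))

end Orbit

/-! ### The explicit vector n a_α γ₀ v₀ -/

section Field

variable {F : Type*} [Field F]

theorem mulVec_v₀ (θ x₁ x₂ x₃ : F) (α : Fˣ) :
    (nMat x₁ x₂ x₃ * aMat α * γ₀ F) *ᵥ v₀ θ =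
      ![2 * θ * α - x₁ + (-x₁ * x₃ - x₂ ^ 2 / 2) * (α : F)⁻¹, x₁ * (α : F)⁻¹, x₂ * (α : F)⁻¹,
        1 + x₃ * (α : F)⁻¹, (α : F)⁻¹] := by
  have h₁ : γ₀ F *ᵥ v₀ θ = ![2 * θ, 0, 0, 1, 1] := by
    ext i
    fin_cases i <;> simp [γ₀, v₀, Matrix.mulVec, dotProduct, Fin.sum_univ_five]
  have h₂ : aMat α *ᵥ ![2 * θ, 0, 0, 1, 1] = ![2 * θ * α, 0, 0, 1, (α : F)⁻¹] := by
    ext i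
    fin_cases i <;> simp [aMat, Matrix.mulVec_diagonal, mul_comm]
  rw [← Matrix.mulVec_mulVec, h₁, ← Matrix.mulVec_mulVec, h₂]
  ext i
  fin_cases i <;> simp [nMat, Matrix.mulVec, dotProduct, Fin.sum_univ_five]
  ring

theorem quadForm_mulVec_v₀ (h2 : (2 : F) ≠ 0) (θ x₁ x₂ x₃ : F) (α : Fˣ) :
    quadForm ((nMat x₁ x₂ x₃ * aMat α * γ₀ F) *ᵥ v₀ θ) = 4 * θ := by
  rw [quadForm_eq, mulVec_v₀]
  have := α.ne_zero
  simp
  field_simp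
  ring

end Field

/-! ### K-orbits on the quadric Q = 4θ, and the region of integration -/

section LocalField

variable {F : Type*} [Field F] [ValuativeRel F]

theorem mem_orbitK_smul_iff (c : F) (u : Fin 5 → 𝒪[F]) (w : Fin 5 → F) :
    w ∈ orbitK (c • fun i => (u i : F)) ↔ ∃ u', SORel u u' ∧ w = c • fun i => (u' i : F) := by
  have key (k : Matrix (Fin 5) (Fin 5) 𝒪[F]) : k.map (algebraMap 𝒪[F] F) *ᵥ
      (c • fun i => (u i : F)) = c • fun i => ((k *ᵥ u) i : F) := by
    rw [Matrix.mulVec_smul]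
    congr 1
  constructor
  · rintro ⟨k, hk, rfl⟩
    exact ⟨_, ⟨k, hk, rfl⟩, key _⟩
  · rintro ⟨_, ⟨k, hk, rfl⟩, rfl⟩
    exact ⟨k, hk, (key _).symm⟩

/-- Scaling d_n v₁ by ϖ^n gives the primitive integral vector (2θϖ^(2n), 0, 0, ϖ^n, 1). Elements of
K preserve primitivity and Q, and conversely Witt's theorem makes these two invariants sufficient.
-/
theorem mem_orbitK_iff (h2 : valuation F (2 : F) = 1) {ϖ : Fˣ} (hϖ : valuation F (ϖ : F) ≤ 1)
    {θ : F} (hθ : valuation F θ = 1) (n : ℕ) {w : Fin 5 → F} (hw : quadForm w = 4 * θ) :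
    w ∈ orbitK (aMat (ϖ ^ n) *ᵥ v₁ θ) ↔ (∀ j, valuation F (w j * ϖ ^ n) ≤ 1) ∧
      ∃ j, valuation F (w j * ϖ ^ n) = 1 := by
  have hp : valuation F ((ϖ : F) ^ n) ≤ 1 := by rw [map_pow]; exact pow_le_one₀ zero_le hϖ
  let t : 𝒪[F] := ⟨2 * θ, by simp [Valuation.mem_integer_iff, h2, hθ]⟩
  let p : 𝒪[F] := ⟨(ϖ : F) ^ n, hp⟩
  have hp0 : (ϖ : F) ^ n ≠ 0 := pow_ne_zero _ ϖ.ne_zero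
  have h2u : IsUnit (2 : 𝒪[F]) := (isUnit_integer_iff _).2 h2
  let e : Fin 5 → 𝒪[F] := ![t * p ^ 2, 0, 0, p, 1]
  have he : (aMat (ϖ ^ n) *ᵥ v₁ θ) = ((ϖ : F) ^ n)⁻¹ • fun i => (e i : F) := by
    ext i
    fin_cases i <;> simp [aMat, v₁, Matrix.mulVec_diagonal, e, t, p, hp0]
    field_simp
  have heu : ∃ i, IsUnit (e i) := ⟨4, by simp [e]⟩
  rw [he, mem_orbitK_smul_iff]
  constructor
  · rintro ⟨u', hu, rfl⟩
    have hj (j) : (((ϖ : F) ^ n)⁻¹ • fun i => (u' i : F)) j * ϖ ^ n = u' j := by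
      simp [mul_comm, hp0]
    simp_rw [hj]
    refine ⟨fun j => (u' j).2, ?_⟩
    obtain ⟨i, hi⟩ := hu.exists_isUnit heu
    exact ⟨i, (isUnit_integer_iff _).1 hi⟩
  · rintro ⟨h1, j, hj⟩
    refine ⟨fun i => ⟨w i * ϖ ^ n, h1 i⟩, ?_, ?_⟩
    · refine sorel_of_quadForm_eq h2u heu ⟨j, (isUnit_integer_iff _).2 hj⟩ (Subtype.ext ?_)
      rw [quadForm_eq] at hw ⊢
      rw [quadForm_eq]
      have c2 : ((2 : 𝒪[F]) : F) = 2 := rfl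
      simp [e, t, p, c2]
      linear_combination -((ϖ : F) ^ n) ^ 2 * hw
    · ext i
      simp [mul_comm, hp0]

/-- The largest coordinate of w has absolute value |ϖ|^(-n) for a single n ≥ 0, so exactly one φ_i
is nonzero at w, the one with i = n. The sum up to r therefore tests n ≤ r. -/
theorem Φ_eq_indicator [IsDiscreteValuationRing 𝒪[F]] (h2 : valuation F (2 : F) = 1) {ϖ : Fˣ}
    (hϖ : IsUniformizer ϖ)
    {θ : F} (hθ : valuation F θ = 1) (r : ℕ) {w : Fin 5 → F} (hw : quadForm w = 4 * θ) :
    Φ ϖ θ r w = Set.indicator {w : Fin 5 → F | ∀ j, valuation F (w j * ϖ ^ r) ≤ 1} 1 w := by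
  have hlt := hϖ.valuation_lt_one
  have hpos : 0 < valuation F (ϖ : F) := zero_lt_iff.2 (by simp)
  obtain ⟨j, -, hj⟩ := Finset.exists_max_image Finset.univ (fun i => valuation F (w i)) ⟨0, by simp⟩
  replace hj : ∀ i, valuation F (w i) ≤ valuation F (w j) := fun i => hj i (Finset.mem_univ i)
  have h4 : valuation F (4 * θ) = 1 := by
    rw [map_mul, hθ, show (4 : F) = 2 * 2 by norm_num, map_mul, h2]; simp
  -- If all coordinates had absolute value below 1, so would Q(w) = 4θ, which is a unit.
  have hj1 : 1 ≤ valuation F (w j) := by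
    by_contra! hcon
    have hlt' : ∀ i k, valuation F (w i * w k) < 1 := fun i k => by
      rw [map_mul]
      exact mul_lt_one_of_lt_of_le ((hj i).trans_lt hcon) ((hj k).trans_lt hcon).le
    have : valuation F (quadForm w) < 1 := by
      rw [quadForm_eq, mul_assoc, mul_assoc, pow_two]
      refine (valuation F).map_add_lt ((valuation F).map_add_lt ?_ ?_) (hlt' _ _)
      all_goals rw [map_mul, h2, one_mul]; exact hlt' _ _
    rw [hw, h4] at this
    exact this.false
  have hj0 : w j ≠ 0 := by
    intro h; rw [h, map_zero] at hj1; exact absurd hj1 (by simp)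
  obtain ⟨n, hn⟩ := hϖ.exists_valuation_eq_pow (x := (w j)⁻¹)
    (by rw [map_inv₀]; exact inv_le_one_of_one_le₀ hj1) (inv_ne_zero hj0)
  have hj' : valuation F (w j) = (valuation F (ϖ : F) ^ n)⁻¹ := by
    rw [← hn, map_inv₀, inv_inv]
  have hle : ∀ i : ℕ, (∀ k, valuation F (w k * ϖ ^ i) ≤ 1) ↔ n ≤ i := fun i => by
    have : (∀ k, valuation F (w k * ϖ ^ i) ≤ 1) ↔ valuation F (w j * ϖ ^ i) ≤ 1 := by
      refine ⟨fun h => h j, fun h k => le_trans ?_ h⟩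
      rw [map_mul, map_mul]
      gcongr
      exact hj k
    rw [this, map_mul, hj', map_pow, inv_mul_le_iff₀ (pow_pos hpos n), mul_one,
      pow_le_pow_iff_right_of_lt_one₀ hpos hlt]
  have hmem : ∀ i : ℕ, φ ϖ θ i w = if i = n then 1 else 0 := fun i => by
    have : w ∈ orbitK (aMat (ϖ ^ i) *ᵥ v₁ θ) ↔ i = n := by
      rw [mem_orbitK_iff h2 hlt.le hθ i hw, hle]
      constructor
      · rintro ⟨hni, k, hk⟩
        refine le_antisymm (not_lt.1 fun hlt' => ?_) hni
        have h5 : valuation F (w k * ϖ ^ i) ≤ valuation F (w j * ϖ ^ i) := by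
          rw [map_mul, map_mul]
          gcongr
          exact hj k
        rw [hk, map_mul, hj', map_pow, ← div_eq_inv_mul, one_le_div₀ (pow_pos hpos n),
          pow_le_pow_iff_right_of_lt_one₀ hpos hlt] at h5
        omega
      · rintro rfl
        refine ⟨le_rfl, j, ?_⟩
        rw [map_mul, hj', map_pow, inv_mul_cancel₀ (pow_pos hpos _).ne']
    classical
    rw [φ, Set.indicator_apply]
    simp only [this, Pi.one_apply]
  classical
  rw [Set.indicator_apply]
  simp only [Φ, Finset.sum_apply, hmem, Finset.sum_ite_eq', Finset.mem_range,
    Set.mem_ofPred_eq, hle, Pi.one_apply, Nat.lt_succ_iff]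

/-- The region of integration of the orbital integral, in the coordinates `(x₁, x₂, x₃ + α)`. -/
def region (b α θ : F) : Set (F × F × F) :=
  {p | valuation F p.1 ≤ valuation F b ∧ valuation F p.2.1 ≤ valuation F b ∧
    valuation F p.2.2 ≤ valuation F b ∧
    valuation F (p.1 * p.2.2 + p.2.1 ^ 2 / 2 - 2 * θ * α ^ 2) ≤ valuation F b}

/-- Times ϖ^r, each coordinate is a polynomial divided by b. The last one is 1/b, whence |b| ≥ 1;
coordinate 0 factors in terms of x₃ + α and gives the quadratic condition. -/
theorem Φ_mulVec_v₀ [IsDiscreteValuationRing 𝒪[F]] (h2 : valuation F (2 : F) = 1) {ϖ : Fˣ}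
    (hϖ : IsUniformizer ϖ) {θ : F} (hθ : valuation F θ = 1) (r : ℕ) {α b : Fˣ}
    (hb : α = b * ϖ ^ r) (x : F × F × F) :
    Φ ϖ θ r ((nMat x.1 x.2.1 x.2.2 * aMat α * γ₀ F) *ᵥ v₀ θ) =
      Set.indicator {p | 1 ≤ valuation F (b : F) ∧ p ∈ region (b : F) α θ} 1
        (x.1, x.2.1, x.2.2 + α) := by
  have h20 : (2 : F) ≠ 0 := by
    intro h; rw [h, map_zero] at h2; exact zero_ne_one h2
  rw [Φ_eq_indicator h2 hϖ hθ r (quadForm_mulVec_v₀ h20 θ _ _ _ α)]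
  have hα : ((α⁻¹ : Fˣ) : F) * (ϖ : F) ^ r = (b : F)⁻¹ := by
    rw [hb]
    simp
    field_simp
  have hα1 : (α : F) * (α : F)⁻¹ = 1 := mul_inv_cancel₀ α.ne_zero
  have hbpos : 0 < valuation F (b : F) := zero_lt_iff.2 (by simp)
  have hle : ∀ y z : F, y = z * (b : F)⁻¹ →
      (valuation F y ≤ 1 ↔ valuation F z ≤ valuation F (b : F)) := by
    rintro _ z rfl
    rw [map_mul, map_inv₀, ← div_eq_mul_inv, div_le_one₀ hbpos]
  have hiff : (∀ j, valuation F (((nMat x.1 x.2.1 x.2.2 * aMat α * γ₀ F) *ᵥ v₀ θ) j * ϖ ^ r) ≤ 1) ↔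
      1 ≤ valuation F (b : F) ∧ (x.1, x.2.1, x.2.2 + (α : F)) ∈ region (b : F) α θ := by
    rw [Fin.forall_fin_succ, Fin.forall_fin_succ, Fin.forall_fin_succ, Fin.forall_fin_succ,
      Fin.forall_fin_one]
    rw [hle _ (-(x.1 * (x.2.2 + α) + x.2.1 ^ 2 / 2 - 2 * θ * α ^ 2)) ?_, hle _ x.1 ?_,
      hle _ x.2.1 ?_, hle _ (x.2.2 + α) ?_, hle _ 1 ?_, Valuation.map_neg, map_one]
    · simp only [region, Set.mem_ofPred_eq]
      tauto
    all_goals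
      rw [← hα, mulVec_v₀]
      simp
    all_goals
      field_simp
      try ring
  classical
  rw [Set.indicator_apply, Set.indicator_apply]
  simp only [Set.mem_ofPred_eq, hiff, Pi.one_apply]

end LocalField

/-! ### Haar integration on F -/

section Integral

variable {F : Type*} [Field F] [ValuativeRel F] [TopologicalSpace F]
  [IsNonarchimedeanLocalField F]

attribute [local instance] t2Space secondCountableTopology

/-- Continuity of ψ is not assumed; it follows because ψ is constant on cosets of the open subgroup
R. -/
theorem continuous_addChar {ψ : AddChar F ℂ} (hψ : ∀ x : F, valuation F x ≤ 1 → ψ x = 1) :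
    Continuous ψ := by
  rw [continuous_iff_continuousAt]
  intro x
  refine (continuousAt_const (y := ψ x)).congr ?_
  have ho : IsOpen {y : F | valuation F (y - x) ≤ valuation F 1} :=
    (isClopen_setOf_valuation_le one_ne_zero).2.preimage (continuous_id.sub continuous_const)
  filter_upwards [ho.mem_nhds (by simp)] with y hy
  have h1 := hψ (y - x) (by simpa using hy)
  have h2 : ψ y = ψ (y - x) * ψ x := by rw [← AddChar.map_add_eq_mul, sub_add_cancel]
  rw [h2, h1, one_mul]

variable [MeasurableSpace F] [BorelSpace F] (μ : Measure F) [μ.IsAddHaarMeasure]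

/-- Invariance of μ gives I = cI. Integrability is not needed, since both identities used also hold
for the default value 0. -/
theorem integral_eq_zero_of_translate {f : F → ℂ} {t : F} {c : ℂ} (hc : c ≠ 1)
    (hf : ∀ x, f (x + t) = c * f x) : ∫ x, f x ∂μ = 0 := by
  have h := integral_add_right_eq_self (μ := μ) f t
  simp_rw [hf] at h
  rw [integral_const_mul] at h
  have : (c - 1) * ∫ x, f x ∂μ = 0 := by linear_combination h
  exact (mul_eq_zero.1 this).resolve_left (sub_ne_zero.2 hc)

/-- The Jacobian |y| appears as the volume of the ball yR. The push-forward of μ under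
multiplication by y is a Haar measure giving yR mass 1, and Haar measures are proportional. -/
theorem integral_eq_measureReal_mul_integral_comp_mul (hμ : μ {x : F | valuation F x ≤ 1} = 1)
    {y : F} (hy : y ≠ 0) (g : F → ℂ) :
    ∫ x, g x ∂μ = (μ.real {x : F | valuation F x ≤ valuation F y} : ℂ) * ∫ z, g (y * z) ∂μ := by
  let e : F ≃ₜ F := Homeomorph.mulLeft₀ y hy
  let ea : F ≃+ F := AddEquiv.mk e.toEquiv (fun a b => mul_add y a b)
  have hH : (Measure.map e μ).IsAddHaarMeasure :=
    ea.isAddHaarMeasure_map μ e.continuous e.symm.continuous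
  have hsm := Measure.isAddLeftInvariant_eq_smul μ (Measure.map e μ)
  have h1 : (Measure.map e μ) {x : F | valuation F x ≤ valuation F y} = 1 := by
    rw [Measure.map_apply e.continuous.measurable
      (isClopen_setOf_valuation_le hy).1.measurableSet, ← hμ]
    congr 1
    ext z
    have : 0 < valuation F y := zero_lt_iff.2 (by simpa using hy)
    simp [e, mul_le_iff_le_one_right this]
  set c := μ.addHaarScalarFactor (Measure.map e μ)
  have hc : (μ.real {x : F | valuation F x ≤ valuation F y}) = c := by
    rw [hsm, measureReal_nnreal_smul_apply]
    simp [measureReal_def, h1]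
  rw [hc]
  conv_lhs => rw [hsm]
  rw [integral_smul_nnreal_measure, e.measurableEmbedding.integral_map]
  rfl

/-- The ball ϖ⁻¹R is the disjoint union of q cosets of R, indexed by the residue class of xϖ. -/
theorem measure_setOf_valuation_le_inv (hμ : μ {x : F | valuation F x ≤ 1} = 1) {ϖ : Fˣ}
    (hϖ : IsUniformizer ϖ) :
    μ {x : F | valuation F x ≤ valuation F (ϖ : F)⁻¹} = Nat.card 𝓀[F] := by
  have hpos : 0 < valuation F (ϖ : F) := zero_lt_iff.2 (by simp)
  obtain ⟨s, hs⟩ : ∃ s : 𝓀[F] → 𝒪[F], ∀ k, IsLocalRing.residue _ (s k) = k :=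
    ⟨_, Function.surjInv_eq IsLocalRing.residue_surjective⟩
  let C : 𝓀[F] → Set F := fun k => {x | valuation F (x - s k * (ϖ : F)⁻¹) ≤ 1}
  have hC : ∀ k x (hx : valuation F (x * ϖ) ≤ 1), x ∈ C k ↔
      IsLocalRing.residue 𝒪[F] ⟨x * ϖ, hx⟩ = k := by
    intro k x hx
    have h1 : x - s k * (ϖ : F)⁻¹ = (x * ϖ - s k) * (ϖ : F)⁻¹ := by field_simp
    conv_rhs => rw [← hs k]
    rw [← sub_eq_zero, ← map_sub, IsLocalRing.residue_eq_zero_iff,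
      mem_maximalIdeal_integer_iff]
    change valuation F (x - s k * (ϖ : F)⁻¹) ≤ 1 ↔ valuation F (x * ϖ - s k) < 1
    rw [h1, map_mul, map_inv₀, ← div_eq_mul_inv, div_le_one₀ hpos]
    exact ⟨fun h => h.trans_lt hϖ.valuation_lt_one, hϖ.le_of_lt_one⟩
  have hball : ∀ x : F, valuation F (x * ϖ) ≤ 1 ↔ valuation F x ≤ valuation F (ϖ : F)⁻¹ := by
    intro x
    rw [map_mul, map_inv₀, ← one_div, le_div_iff₀ hpos]
  have hU : {x : F | valuation F x ≤ valuation F (ϖ : F)⁻¹} = ⋃ k, C k := by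
    ext x
    simp only [Set.mem_iUnion, Set.mem_ofPred_eq]
    rw [← hball]
    constructor
    · exact fun hx => ⟨_, (hC _ x hx).2 rfl⟩
    · rintro ⟨k, hk⟩
      have h2 : x * ϖ = (x - s k * (ϖ : F)⁻¹) * ϖ + s k := by field_simp; ring
      rw [h2]
      refine (valuation F).map_add_le ?_ (s k).2
      rw [map_mul]
      exact mul_le_one' hk hϖ.valuation_lt_one.le
  have hCm : ∀ k, μ (C k) = 1 := by
    intro k
    rw [← hμ, ← measure_preimage_add_right μ (-(s k * (ϖ : F)⁻¹)) {x : F | valuation F x ≤ 1}]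
    simp [C, sub_eq_add_neg]
  have hCmeas : ∀ k, MeasurableSet (C k) := by
    intro k
    have := (isClopen_setOf_valuation_le (F := F) one_ne_zero).1.measurableSet.preimage
      (measurable_sub_const (s k * (ϖ : F)⁻¹))
    simpa [C] using this
  have hCd : Pairwise (Function.onFun Disjoint C) := by
    intro k l hkl
    refine Set.disjoint_left.2 fun x hx hx' => hkl ?_
    have hx1 : valuation F (x * ϖ) ≤ 1 :=
      (hball x).2 (hU.symm.subset (Set.mem_iUnion.2 ⟨k, hx⟩))
    rw [← (hC k x hx1).1 hx, ← (hC l x hx1).1 hx']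
  have := Fintype.ofFinite 𝓀[F]
  rw [hU, measure_iUnion hCd hCmeas]
  simp [hCm]

end Integral

theorem addChar_add_eq {F : Type*} [Field F] [ValuativeRel F] {ψ : AddChar F ℂ}
    (hψ : ∀ x : F, valuation F x ≤ 1 → ψ x = 1) {x y : F} (h : valuation F (x - y) ≤ 1) :
    ψ x = ψ y := by
  rw [← sub_add_cancel x y, AddChar.map_add_eq_mul, hψ _ h, one_mul]

/-! ### The inner integral over x₁ and the sphere integrals -/

section Integral

variable {F : Type*} [Field F] [ValuativeRel F] [TopologicalSpace F]
  [IsNonarchimedeanLocalField F]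

attribute [local instance] t2Space secondCountableTopology

theorem isClosed_region {b : F} (hb : b ≠ 0) (α θ : F) : IsClosed (region b α θ) := by
  have hB := (isClopen_setOf_valuation_le hb).1
  refine (hB.preimage continuous_fst).inter ((hB.preimage (by fun_prop)).inter
    ((hB.preimage (by fun_prop)).inter (hB.preimage (f := fun p : F × F × F =>
      p.1 * p.2.2 + p.2.1 ^ 2 / 2 - 2 * θ * α ^ 2) (by fun_prop))))

theorem isCompact_region {b : F} (hb : b ≠ 0) (α θ : F) : IsCompact (region b α θ) := by
  have hB := isCompact_setOf_valuation_le b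
  exact (hB.prod (hB.prod hB)).of_isClosed_subset (isClosed_region hb α θ)
    fun p hp => ⟨hp.1, hp.2.1, hp.2.2.1⟩

variable [MeasurableSpace F] [BorelSpace F] (μ : Measure F) [μ.IsAddHaarMeasure]
  {ψ : AddChar F ℂ}

theorem integrable_region (hψ : ∀ x : F, valuation F x ≤ 1 → ψ x = 1)
    {b : F} (hb : b ≠ 0) (α θ c : F) :
    Integrable ((region b α θ).indicator fun p => ψ (p.1 + 2 * θ * p.2.2 + c))
      (μ.prod (μ.prod μ)) := by
  have hψc := continuous_addChar hψ
  rw [integrable_indicator_iff (isClosed_region hb α θ).measurableSet]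
  exact ContinuousOn.integrableOn_compact (isCompact_region hb α θ)
    (by fun_prop : Continuous _).continuousOn

/-- Integrating out the first coordinate of the region, away from the outer sphere. -/
theorem integral_fst_eq_zero {ϖ : Fˣ} (hϖ : IsUniformizer ϖ)
    (hψ' : ∃ x : F, valuation F x ≤ valuation F (ϖ : F)⁻¹ ∧ ψ x ≠ 1)
    {b y : F} (hb : 1 < valuation F b) (hy : valuation F y < valuation F b) (D : F) :
    ∫ x, {x | valuation F x ≤ valuation F b ∧ valuation F (x * y + D) ≤ valuation F b}.indicator
      ψ x ∂μ = 0 := by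
  obtain ⟨t, ht, hψt⟩ := hψ'
  have hpos : 0 < valuation F (ϖ : F) := zero_lt_iff.2 (by simp)
  -- Discreteness gives |y| ≤ |ϖ||b| and 1 ≤ |ϖ||b|, so translation by t in ϖ⁻¹R preserves both
  -- conditions on x.
  have hy' := hϖ.le_mul_of_lt hy
  have hb' := hϖ.le_mul_of_lt (x := 1) (y := b) (by simpa using hb)
  have htb : valuation F t ≤ valuation F b := by
    refine ht.trans ?_
    rw [map_inv₀, inv_le_iff_one_le_mul₀ hpos, mul_comm]
    simpa using hb'
  have hty : valuation F (t * y) ≤ valuation F b := by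
    rw [map_mul]
    calc _ ≤ valuation F (ϖ : F)⁻¹ * (valuation F (ϖ : F) * valuation F b) :=
          mul_le_mul' ht hy'
      _ = _ := by rw [map_inv₀, ← mul_assoc, inv_mul_cancel₀ hpos.ne', one_mul]
  refine integral_eq_zero_of_translate μ hψt (t := t) fun x => ?_
  have h1 : valuation F (x + t) ≤ valuation F b ↔ valuation F x ≤ valuation F b :=
    ⟨fun h => by simpa using (valuation F).map_sub_le h htb, fun h => (valuation F).map_add_le h htb⟩
  have h2 : valuation F ((x + t) * y + D) ≤ valuation F b ↔
      valuation F (x * y + D) ≤ valuation F b := by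
    have : (x + t) * y + D = (x * y + D) + t * y := by ring
    rw [this]
    exact ⟨fun h => by simpa using (valuation F).map_sub_le h hty,
      fun h => (valuation F).map_add_le h hty⟩
  classical
  rw [Set.indicator_apply, Set.indicator_apply]
  simp only [Set.mem_ofPred_eq, h1, h2, AddChar.map_add_eq_mul, mul_ite, mul_zero,
    mul_comm (ψ x)]

/-- Integrating out the first coordinate of the region, on the outer sphere. -/
theorem integral_fst_eq (hψ : ∀ x : F, valuation F x ≤ 1 → ψ x = 1)
    (hμ : μ {x : F | valuation F x ≤ 1} = 1)
    {b y D : F} (hb : 1 < valuation F b) (hy : valuation F y = valuation F b)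
    (hD : valuation F D ≤ valuation F b ^ 2) :
    ∫ x, {x | valuation F x ≤ valuation F b ∧ valuation F (x * y + D) ≤ valuation F b}.indicator
      ψ x ∂μ = ψ (-(D / y)) := by
  have hpos : 0 < valuation F b := zero_lt_one.trans hb
  have hy0 : y ≠ 0 := by
    intro h; rw [h, map_zero] at hy; exact hpos.ne hy
  have hDy : valuation F (D / y) ≤ valuation F b := by
    rw [map_div₀, hy, div_le_iff₀ hpos, ← pow_two]
    exact hD
  -- Centring at -D/y turns xy + D into xy, and the conditions reduce to x ∈ R, where ψ is trivial.
  rw [← integral_add_right_eq_self _ (-(D / y))]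
  have h1 : ∀ x : F, (valuation F (x + -(D / y)) ≤ valuation F b ∧
      valuation F ((x + -(D / y)) * y + D) ≤ valuation F b) ↔ valuation F x ≤ 1 := by
    intro x
    have : (x + -(D / y)) * y + D = x * y := by field_simp; ring
    rw [this, map_mul, hy, mul_le_iff_le_one_left hpos]
    refine ⟨And.right, fun h => ⟨(valuation F).map_add_le (h.trans hb.le) ?_, h⟩⟩
    rwa [Valuation.map_neg]
  have h2 : ∀ x : F, ({x | valuation F x ≤ valuation F b ∧
      valuation F (x * y + D) ≤ valuation F b}.indicator ψ (x + -(D / y)) : ℂ) =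
      {x : F | valuation F x ≤ 1}.indicator (fun _ => ψ (-(D / y))) x := by
    intro x
    classical
    rw [Set.indicator_apply, Set.indicator_apply]
    simp only [Set.mem_ofPred_eq, h1]
    split_ifs with h
    · exact addChar_add_eq hψ (by simpa using h)
    · rfl
  simp_rw [h2]
  rw [integral_indicator_const]
  · simp [measureReal_def, hμ]
  · simpa using (isClopen_setOf_valuation_le (F := F) one_ne_zero).1.measurableSet

/-- Translating y by s/w, with s in ϖ⁻¹R and ψ(s) ≠ 1, preserves the sphere. It multiplies ψ(wy) by
ψ(s) and changes c/y by an element of absolute value at most |ϖ|, invisible to ψ. -/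
theorem integral_sphere_eq_zero (hψ : ∀ x : F, valuation F x ≤ 1 → ψ x = 1)
    {ϖ : Fˣ} (hϖ : IsUniformizer ϖ)
    (hψ' : ∃ x : F, valuation F x ≤ valuation F (ϖ : F)⁻¹ ∧ ψ x ≠ 1)
    {b w c : F} (hb : valuation F (ϖ : F)⁻¹ < valuation F b) (hw : valuation F w = 1)
    (hc : valuation F c ≤ valuation F (ϖ : F) ^ 2 * valuation F b ^ 2) :
    ∫ y, {y | valuation F y = valuation F b}.indicator (fun y => ψ (w * y + c / y)) y ∂μ = 0 := by
  obtain ⟨s, hs, hψs⟩ := hψ'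
  have hpos : 0 < valuation F (ϖ : F) := zero_lt_iff.2 (by simp)
  have hbpos : 0 < valuation F b := zero_le.trans_lt hb
  have hw0 : w ≠ 0 := by
    intro h; rw [h, map_zero] at hw; exact zero_ne_one hw
  have hsw : valuation F (s / w) ≤ valuation F (ϖ : F)⁻¹ := by rwa [map_div₀, hw, div_one]
  refine integral_eq_zero_of_translate μ hψs (t := s / w) fun y => ?_
  have h1 : valuation F (y + s / w) = valuation F b ↔ valuation F y = valuation F b := by
    constructor
    · intro h
      have := (valuation F).map_add_eq_of_lt_left (x := y + s / w) (y := -(s / w))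
        (by rw [Valuation.map_neg, h]; exact hsw.trans_lt hb)
      rwa [add_neg_cancel_right, h] at this
    · intro h
      rw [(valuation F).map_add_eq_of_lt_left (by rw [h]; exact hsw.trans_lt hb), h]
  classical
  rw [Set.indicator_apply, Set.indicator_apply]
  simp only [Set.mem_ofPred_eq, h1, mul_ite, mul_zero]
  split_ifs with h
  · rw [← AddChar.map_add_eq_mul]
    refine addChar_add_eq hψ ?_
    have hy0 : y ≠ 0 := by
      intro h'; rw [h', map_zero] at h; exact hbpos.ne h
    have hy1 : y + s / w ≠ 0 := by
      intro h'; have := h1.2 h; rw [h', map_zero] at this; exact hbpos.ne this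
    have h2 : w * (y + s / w) + c / (y + s / w) - (s + (w * y + c / y)) =
        -(c * (s / w) / (y * (y + s / w))) := by
      have h3 : w * (y + s / w) = w * y + s := by field_simp
      rw [h3, neg_eq_neg_one_mul, sub_eq_iff_eq_add, ← sub_eq_zero]
      generalize s / w = t at hy1 ⊢
      field_simp
      ring
    rw [h2, Valuation.map_neg, map_div₀, map_mul, map_mul, h, h1.2 h,
      div_le_one₀ (mul_pos hbpos hbpos)]
    calc _ ≤ (valuation F (ϖ : F) ^ 2 * valuation F b ^ 2) * valuation F (ϖ : F)⁻¹ :=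
          mul_le_mul' hc hsw
      _ = valuation F (ϖ : F) * (valuation F b * valuation F b) := by
          rw [map_inv₀]; field_simp
      _ ≤ _ := mul_le_of_le_one_left' hϖ.valuation_lt_one.le
  · rfl

/-- Here c/y is integral and drops out. By discreteness the sphere is ϖ⁻¹R minus R; ψ(wy) integrates
to 0 over the former and to 1 over the latter. -/
theorem integral_sphere_eq_neg_one (hψ : ∀ x : F, valuation F x ≤ 1 → ψ x = 1)
    (hμ : μ {x : F | valuation F x ≤ 1} = 1)
    {ϖ : Fˣ} (hϖ : IsUniformizer ϖ)
    (hψ' : ∃ x : F, valuation F x ≤ valuation F (ϖ : F)⁻¹ ∧ ψ x ≠ 1)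
    {b w c : F} (hb : valuation F b = valuation F (ϖ : F)⁻¹) (hw : valuation F w = 1)
    (hc : valuation F c ≤ valuation F (ϖ : F) ^ 2 * valuation F b ^ 2) :
    ∫ y, {y | valuation F y = valuation F b}.indicator (fun y => ψ (w * y + c / y)) y ∂μ = -1 := by
  obtain ⟨s, hs, hψs⟩ := hψ'
  have hψc := continuous_addChar hψ
  have hpos : 0 < valuation F (ϖ : F) := zero_lt_iff.2 (by simp)
  have hbpos : 0 < valuation F b := by rw [hb]; exact zero_lt_iff.2 (by simp)
  have hb0 : b ≠ 0 := by
    rintro rfl; simp at hbpos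
  have hb1 : 1 < valuation F b := by
    rw [hb, map_inv₀]; exact (one_lt_inv₀ hpos).2 hϖ.valuation_lt_one
  have hw0 : w ≠ 0 := by
    intro h; rw [h, map_zero] at hw; exact zero_ne_one hw
  have hc1 : valuation F c ≤ 1 := by
    refine hc.trans_eq ?_
    rw [hb, map_inv₀, inv_pow, mul_inv_cancel₀ (pow_pos hpos 2).ne']
  have hO := (isClopen_setOf_valuation_le (F := F) one_ne_zero).1.measurableSet
  rw [map_one] at hO
  have hB := (isClopen_setOf_valuation_le hb0).1.measurableSet
  have hsplit : ∀ y, {y | valuation F y = valuation F b}.indicator (fun y => ψ (w * y + c / y)) y =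
      {y | valuation F y ≤ valuation F b}.indicator (fun y => ψ (w * y)) y -
        {y : F | valuation F y ≤ 1}.indicator (fun _ => (1 : ℂ)) y := by
    intro y
    classical
    simp only [Set.indicator_apply, Set.mem_ofPred_eq]
    rcases lt_trichotomy (valuation F y) (valuation F b) with h | h | h
    · have h1 : valuation F y ≤ 1 := by
        have := hϖ.le_mul_of_lt h
        rwa [hb, map_inv₀, mul_inv_cancel₀ hpos.ne'] at this
      rw [if_neg h.ne, if_pos h.le, if_pos h1, hψ _ (by rwa [map_mul, hw, one_mul]), sub_self]
    · rw [if_pos h, if_pos h.le, if_neg (by rw [h]; exact not_le.2 hb1), sub_zero]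
      refine addChar_add_eq hψ ?_
      rw [add_sub_cancel_left, map_div₀, h]
      exact (div_le_one₀ hbpos).2 (hc1.trans hb1.le)
    · rw [if_neg h.ne', if_neg h.not_ge, if_neg (not_le.2 (hb1.trans h)), sub_zero]
  have hzero : ∫ y, {y | valuation F y ≤ valuation F b}.indicator (fun y => ψ (w * y)) y ∂μ = 0 := by
    refine integral_eq_zero_of_translate μ hψs (t := s / w) fun y => ?_
    have hsw : valuation F (s / w) ≤ valuation F b := by rwa [map_div₀, hw, div_one, hb]
    have h1 : valuation F (y + s / w) ≤ valuation F b ↔ valuation F y ≤ valuation F b :=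
      ⟨fun h => by simpa using (valuation F).map_sub_le h hsw,
        fun h => (valuation F).map_add_le h hsw⟩
    have h2 : w * (y + s / w) = s + w * y := by field_simp; ring
    classical
    simp only [Set.indicator_apply, Set.mem_ofPred_eq, h1, h2, AddChar.map_add_eq_mul, mul_ite,
      mul_zero]
  have hint : Integrable ({y | valuation F y ≤ valuation F b}.indicator fun y => ψ (w * y)) μ := by
    rw [integrable_indicator_iff hB]
    exact ContinuousOn.integrableOn_compact (isCompact_setOf_valuation_le b)
      (by fun_prop : Continuous _).continuousOn
  have hint' : Integrable ({y : F | valuation F y ≤ 1}.indicator fun _ => (1 : ℂ)) μ := by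
    rw [integrable_indicator_iff hO]
    exact integrableOn_const (by simp [hμ])
  simp_rw [hsplit]
  rw [integral_sub hint hint', hzero, integral_indicator_const _ hO]
  simp [measureReal_def, hμ]

end Integral

/-! ### Evaluation of the orbital integral -/

section Integral

variable {F : Type*} [Field F] [ValuativeRel F] [TopologicalSpace F]
  [IsNonarchimedeanLocalField F]

attribute [local instance] t2Space secondCountableTopology

variable {ψ : AddChar F ℂ} {ϖ : Fˣ} {θ : F} {r : ℕ}

theorem orbInt_integrand_eq (h2 : valuation F (2 : F) = 1) (hϖ : IsUniformizer ϖ)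
    (hθ : valuation F θ = 1) {α b : Fˣ} (hb : α = b * ϖ ^ r) (hb1 : 1 ≤ valuation F (b : F)) :
    (fun x : F × F × F => Φ ϖ θ r ((nMat x.1 x.2.1 x.2.2 * aMat α * γ₀ F) *ᵥ v₀ θ) *
      ψ (x.1 + 2 * θ * x.2.2)) = fun x => (region (b : F) α θ).indicator
        (fun p => ψ (p.1 + 2 * θ * p.2.2 + -(2 * θ * α))) ((0, 0, (α : F)) + x) := by
  ext x
  rw [Φ_mulVec_v₀ h2 hϖ hθ r hb]
  have hx : (0, 0, (α : F)) + x = (x.1, x.2.1, x.2.2 + (α : F)) := by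
    ext <;> simp [add_comm]
  rw [hx]
  classical
  simp only [Set.indicator_apply, Set.mem_ofPred_eq, hb1, true_and, Pi.one_apply, ite_mul, one_mul,
    zero_mul]
  refine if_congr Iff.rfl (congrArg ψ ?_) rfl
  ring

theorem orbInt_integrand_eq_zero (h2 : valuation F (2 : F) = 1) (hϖ : IsUniformizer ϖ)
    (hθ : valuation F θ = 1) {α b : Fˣ} (hb : α = b * ϖ ^ r) (hb1 : valuation F (b : F) < 1) :
    (fun x : F × F × F => Φ ϖ θ r ((nMat x.1 x.2.1 x.2.2 * aMat α * γ₀ F) *ᵥ v₀ θ) *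
      ψ (x.1 + 2 * θ * x.2.2)) = 0 := by
  ext x
  rw [Φ_mulVec_v₀ h2 hϖ hθ r hb, Set.indicator_of_notMem (by simp [hb1]), zero_mul, Pi.zero_apply]

variable [MeasurableSpace F] [BorelSpace F] (μ : Measure F) [μ.IsAddHaarMeasure]

/-- Over a region larger than the unit ball the integral is a multiple of a Kloosterman-type
integral over a sphere, whose value `κ` does not depend on the remaining variable. -/
theorem integral_region_eq (hψ : ∀ x : F, valuation F x ≤ 1 → ψ x = 1)
    (hμ : μ {x : F | valuation F x ≤ 1} = 1) (h2 : valuation F (2 : F) = 1)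
    (hϖ : IsUniformizer ϖ)
    (hψ' : ∃ x : F, valuation F x ≤ valuation F (ϖ : F)⁻¹ ∧ ψ x ≠ 1)
    {b α : F} (hb : 1 < valuation F b) (hα : valuation F α ≤ valuation F b)
    (hθ : valuation F θ = 1) (κ : ℂ)
    (hκ : ∀ z : F, valuation F z ≤ 1 → ∫ y, {y | valuation F y = valuation F b}.indicator
      (fun y => ψ ((2 * θ - z ^ 2 / 2) * y + 2 * θ * α ^ 2 / y)) y ∂μ = κ) :
    ∫ p, (region b α θ).indicator (fun p => ψ (p.1 + 2 * θ * p.2.2)) p ∂(μ.prod (μ.prod μ)) =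
      μ.real {x : F | valuation F x ≤ valuation F b} * κ := by
  have hψc := continuous_addChar hψ
  have hbpos : 0 < valuation F b := zero_lt_one.trans hb
  have hb0 : b ≠ 0 := by
    rintro rfl; simp at hbpos
  have hO := (isClopen_setOf_valuation_le (F := F) one_ne_zero).1.measurableSet
  rw [map_one] at hO
  have hOc := isCompact_setOf_valuation_le (F := F) 1
  rw [map_one] at hOc
  have hB := isCompact_setOf_valuation_le b
  have hS := isCompact_setOf_valuation_eq hb0
  -- the integrand after integrating out `x₁`
  let H : F × F → ℂ := ({x | valuation F x ≤ valuation F b} ×ˢ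
    {y | valuation F y = valuation F b}).indicator
      fun p => ψ (2 * θ * p.2 + (2 * θ * α ^ 2 - p.1 ^ 2 / 2) / p.2)
  have hHint : Integrable H (μ.prod μ) := by
    have hcl : IsClosed ({x | valuation F x ≤ valuation F b} ×ˢ
      {y | valuation F y = valuation F b}) :=
      (isClopen_setOf_valuation_le hb0).1.prod (isClopen_setOf_valuation_eq hb0).1
    rw [integrable_indicator_iff hcl.measurableSet]
    refine ContinuousOn.integrableOn_compact (hB.prod hS) (hψc.comp_continuousOn ?_)
    refine ContinuousOn.add (by fun_prop) (ContinuousOn.div (by fun_prop) (by fun_prop) ?_)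
    rintro p ⟨-, hp⟩ h
    rw [Set.mem_ofPred_eq, show p.2 = 0 from h, map_zero] at hp
    exact hbpos.ne hp
  have hint : Integrable ((region b α θ).indicator fun p => ψ (p.1 + 2 * θ * p.2.2))
      (μ.prod (μ.prod μ)) := by
    simpa using integrable_region μ hψ hb0 α θ 0
  have hfst : ∀ q : F × F, ∫ x, (region b α θ).indicator
      (fun p => ψ (p.1 + 2 * θ * p.2.2)) (x, q) ∂μ = H q := by
    rintro ⟨x₂, y⟩
    have hfac : ∀ x, (region b α θ).indicator (fun p => ψ (p.1 + 2 * θ * p.2.2)) (x, (x₂, y)) =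
        (({x | valuation F x ≤ valuation F b} ×ˢ {y | valuation F y ≤ valuation F b}).indicator
          (fun p => ψ (2 * θ * p.2)) (x₂, y)) *
        {x | valuation F x ≤ valuation F b ∧ valuation F (x * y +
          (x₂ ^ 2 / 2 - 2 * θ * α ^ 2)) ≤ valuation F b}.indicator ψ x := by
      intro x
      classical
      simp only [Set.indicator_apply, region, Set.mem_ofPred_eq, Set.mem_prod, ← add_sub_assoc,
        AddChar.map_add_eq_mul, ite_mul, zero_mul, mul_ite, mul_zero, ← ite_and]
      refine if_congr (by tauto) (mul_comm _ _) rfl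
    simp_rw [hfac]
    rw [integral_const_mul]
    by_cases hx₂ : valuation F x₂ ≤ valuation F b
    swap
    · rw [Set.indicator_of_notMem (by simp [hx₂]), zero_mul]
      exact (Set.indicator_of_notMem (by simp [hx₂]) _).symm
    rcases lt_trichotomy (valuation F y) (valuation F b) with h | h | h
    · rw [integral_fst_eq_zero μ hϖ hψ' hb h, mul_zero]
      exact (Set.indicator_of_notMem (by simp [h.ne]) _).symm
    · have hD : valuation F (x₂ ^ 2 / 2 - 2 * θ * α ^ 2) ≤ valuation F b ^ 2 := by
        refine (valuation F).map_sub_le ?_ ?_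
        · rw [map_div₀, h2, div_one, map_pow]
          gcongr
        · rw [map_mul, map_mul, h2, hθ, one_mul, one_mul, map_pow]
          gcongr
      rw [integral_fst_eq μ hψ hμ hb h hD, Set.indicator_of_mem (by simp [hx₂, h]),
        ← AddChar.map_add_eq_mul]
      refine Eq.trans ?_ (Set.indicator_of_mem (by simp [hx₂, h]) _).symm
      congr 1
      ring
    · rw [Set.indicator_of_notMem (by simp [h]), zero_mul]
      exact (Set.indicator_of_notMem (by simp [h.ne']) _).symm
  rw [integral_prod_symm _ hint]
  simp_rw [hfst]
  rw [integral_prod_symm _ hHint]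
  -- substitute `x₂ = y z`
  let G : F → F → ℂ := fun y z => ({x : F | valuation F x ≤ 1} ×ˢ
    {y | valuation F y = valuation F b}).indicator
      (fun p => ψ ((2 * θ - p.1 ^ 2 / 2) * p.2 + 2 * θ * α ^ 2 / p.2)) (z, y)
  have hsub : ∀ y, ∫ x, H (x, y) ∂μ =
      μ.real {x : F | valuation F x ≤ valuation F b} * ∫ z, G y z ∂μ := by
    intro y
    by_cases hy : valuation F y = valuation F b
    · have hy0 : y ≠ 0 := by
        rintro rfl; rw [map_zero] at hy; exact hbpos.ne hy
      rw [integral_eq_measureReal_mul_integral_comp_mul μ hμ hy0, hy]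
      congr 2 with z
      have hz : valuation F (y * z) ≤ valuation F b ↔ valuation F z ≤ 1 := by
        rw [map_mul, hy, mul_le_iff_le_one_right hbpos]
      classical
      simp only [H, G, Set.indicator_apply, Set.mem_prod, Set.mem_ofPred_eq, hz]
      refine if_congr Iff.rfl (congrArg ψ ?_) rfl
      field_simp
      ring
    · have h1 : ∀ x, H (x, y) = 0 := fun x => Set.indicator_of_notMem (by simp [hy]) _
      have h3 : ∀ z, G y z = 0 := fun x => Set.indicator_of_notMem (by simp [hy]) _
      simp [h1, h3]
  simp_rw [hsub]
  rw [integral_const_mul]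
  congr 1
  have hGint : Integrable (Function.uncurry fun z y => G y z) (μ.prod μ) := by
    have hcl : MeasurableSet ({x : F | valuation F x ≤ 1} ×ˢ
      {y | valuation F y = valuation F b}) :=
      hO.prod (isClopen_setOf_valuation_eq hb0).1.measurableSet
    change Integrable (Set.indicator _ _) _
    rw [integrable_indicator_iff hcl]
    refine ContinuousOn.integrableOn_compact (hOc.prod hS) (hψc.comp_continuousOn ?_)
    refine ContinuousOn.add (by fun_prop) (ContinuousOn.div (by fun_prop) (by fun_prop) ?_)
    rintro p ⟨-, hp⟩ h
    rw [Set.mem_ofPred_eq, show p.2 = 0 from h, map_zero] at hp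
    exact hbpos.ne hp
  -- With z fixed and y integrated first, the inner integral is the constant κ, and z runs over R,
  -- of volume 1.
  rw [← integral_integral_swap hGint]
  have hz : ∀ z, ∫ y, G y z ∂μ = {x : F | valuation F x ≤ 1}.indicator (fun _ => κ) z := by
    intro z
    by_cases hz : valuation F z ≤ 1
    · rw [Set.indicator_of_mem (s := {x : F | valuation F x ≤ 1}) hz, ← hκ z hz]
      congr 1 with y
      classical
      simp only [G, Set.indicator_apply, Set.mem_prod, Set.mem_ofPred_eq, hz, true_and]
    · have h3 : ∀ y, G y z = 0 := fun x => Set.indicator_of_notMem (by simp [hz]) _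
      rw [Set.indicator_of_notMem (s := {x : F | valuation F x ≤ 1}) hz]
      simp [h3]
  simp_rw [hz]
  rw [integral_indicator_const _ hO]
  simp [measureReal_def, hμ]

theorem integral_region_one (hψ : ∀ x : F, valuation F x ≤ 1 → ψ x = 1)
    (hμ : μ {x : F | valuation F x ≤ 1} = 1) (h2 : valuation F (2 : F) = 1)
    {b α : F} (hb : valuation F b = 1) (hα : valuation F α ≤ 1) (hθ : valuation F θ = 1) :
    ∫ p, (region b α θ).indicator (fun p => ψ (p.1 + 2 * θ * p.2.2)) p ∂(μ.prod (μ.prod μ)) = 1 := by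
  have hO := (isClopen_setOf_valuation_le (F := F) one_ne_zero).1.measurableSet
  rw [map_one] at hO
  have hreg : region b α θ = {x : F | valuation F x ≤ 1} ×ˢ ({x : F | valuation F x ≤ 1} ×ˢ
      {x : F | valuation F x ≤ 1}) := by
    ext ⟨x, y, z⟩
    simp only [region, hb, Set.mem_ofPred_eq, Set.mem_prod]
    refine ⟨fun h => ⟨h.1, h.2.1, h.2.2.1⟩, fun h => ⟨h.1, h.2.1, h.2.2, ?_⟩⟩
    refine (valuation F).map_sub_le ((valuation F).map_add_le ?_ ?_) ?_
    · rw [map_mul]; exact mul_le_one' h.1 h.2.2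
    · rw [map_div₀, h2, div_one, map_pow]; exact pow_le_one₀ zero_le h.2.1
    · rw [map_mul, map_mul, h2, hθ, one_mul, one_mul, map_pow]; exact pow_le_one₀ zero_le hα
  have hone : (region b α θ).indicator (fun p => ψ (p.1 + 2 * θ * p.2.2)) =
      (region b α θ).indicator fun _ => 1 := by
    refine Set.indicator_congr fun p hp => hψ _ ?_
    rw [hreg] at hp
    refine (valuation F).map_add_le hp.1 ?_
    rw [map_mul, map_mul, h2, hθ, one_mul, one_mul]
    exact hp.2.2
  rw [hone, hreg, integral_indicator_const _ (hO.prod (hO.prod hO))]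
  simp [measureReal_def, hμ]

theorem isAddLeftInvariant_prod_prod : (μ.prod (μ.prod μ)).IsAddLeftInvariant :=
  Measure.prod.instIsAddLeftInvariant

theorem integrable_orbInt (hψ : ∀ x : F, valuation F x ≤ 1 → ψ x = 1)
    (h2 : valuation F (2 : F) = 1) (hϖ : IsUniformizer ϖ) (hθ : valuation F θ = 1) (α : Fˣ) :
    Integrable (fun x : F × F × F =>
      Φ ϖ θ r ((nMat x.1 x.2.1 x.2.2 * aMat α * γ₀ F) *ᵥ v₀ θ) * ψ (x.1 + 2 * θ * x.2.2))
      (μ.prod (μ.prod μ)) := by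
  have := isAddLeftInvariant_prod_prod μ
  have hb : α = (α * (ϖ ^ r)⁻¹) * ϖ ^ r := by simp
  rcases lt_or_ge (valuation F ((α * (ϖ ^ r)⁻¹ : Fˣ) : F)) 1 with h | h
  · rw [orbInt_integrand_eq_zero h2 hϖ hθ hb h]
    exact integrable_zero _ _ _
  · rw [orbInt_integrand_eq h2 hϖ hθ hb h]
    exact (integrable_region μ hψ (Units.ne_zero _) α θ _).comp_add_left _

theorem orbInt_eq (h2 : valuation F (2 : F) = 1) (hϖ : IsUniformizer ϖ)
    (hθ : valuation F θ = 1) {α b : Fˣ} (hb : α = b * ϖ ^ r) (hb1 : 1 ≤ valuation F (b : F)) :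
    orbInt μ ψ θ (Φ ϖ θ r) α = ψ (-(2 * θ * α)) *
      ∫ p, (region (b : F) α θ).indicator (fun p => ψ (p.1 + 2 * θ * p.2.2)) p
        ∂(μ.prod (μ.prod μ)) := by
  have := isAddLeftInvariant_prod_prod μ
  rw [orbInt, orbInt_integrand_eq h2 hϖ hθ hb hb1, integral_add_left_eq_self, ← integral_const_mul]
  congr 1 with p
  rw [← Set.indicator_const_mul]
  simp only [AddChar.map_add_eq_mul, mul_comm]

/-- The orbital integral is supported on two cosets of the unit group. -/
theorem orbInt_Φ_eq (hchar : ringChar 𝓀[F] ≠ 2) (hψ : ∀ x : F, valuation F x ≤ 1 → ψ x = 1)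
    (hμ : μ {x : F | valuation F x ≤ 1} = 1) (hϖ : IsUniformizer ϖ)
    (hψ' : ∃ x : F, valuation F x ≤ valuation F (ϖ : F)⁻¹ ∧ ψ x ≠ 1)
    (hθ : valuation F θ = 1) (hθ' : ¬ IsSquare θ) (hr : 1 ≤ r) (α : Fˣ) :
    orbInt μ ψ θ (Φ ϖ θ r) α =
      {α : Fˣ | valuation F (α : F) = valuation F ((ϖ ^ r : Fˣ) : F)}.indicator 1 α -
      Nat.card 𝓀[F] * {α : Fˣ | valuation F (α : F) =
        valuation F ((ϖ ^ (r - 1) : Fˣ) : F)}.indicator 1 α := by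
  have h2 := valuation_two hchar
  obtain ⟨b, hb⟩ : ∃ b : Fˣ, α = b * ϖ ^ r := ⟨α * (ϖ ^ r)⁻¹, by simp⟩
  have hpos : 0 < valuation F (ϖ : F) := zero_lt_iff.2 (by simp)
  have hlt := hϖ.valuation_lt_one
  have hbpos : 0 < valuation F (b : F) := zero_lt_iff.2 (by simp)
  have hvα : valuation F (α : F) = valuation F (b : F) * valuation F (ϖ : F) ^ r := by
    rw [hb]; simp
  -- This is where r ≥ 1 enters: it gives the bound on c = 2θα² required by the sphere integrals.
  have hvα' : valuation F (α : F) ≤ valuation F (ϖ : F) * valuation F (b : F) := by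
    rw [hvα, mul_comm]
    gcongr
    exact pow_le_of_le_one zero_le hlt.le (by omega)
  have hm1 : α ∈ {α : Fˣ | valuation F (α : F) = valuation F ((ϖ ^ r : Fˣ) : F)} ↔
      valuation F (b : F) = 1 := by
    rw [Set.mem_ofPred_eq, hvα, Units.val_pow_eq_pow_val, map_pow]
    exact mul_eq_right₀ (pow_pos hpos r).ne'
  have hm2 : α ∈ {α : Fˣ | valuation F (α : F) = valuation F ((ϖ ^ (r - 1) : Fˣ) : F)} ↔
      valuation F (b : F) = valuation F (ϖ : F)⁻¹ := by
    rw [Set.mem_ofPred_eq, hvα, Units.val_pow_eq_pow_val, map_pow, map_inv₀]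
    obtain ⟨s, rfl⟩ : ∃ s, r = s + 1 := ⟨r - 1, by omega⟩
    rw [Nat.add_sub_cancel, pow_succ', ← mul_assoc, mul_eq_right₀ (pow_pos hpos s).ne']
    exact ⟨fun h => eq_inv_of_mul_eq_one_left h, fun h => by rw [h, inv_mul_cancel₀ hpos.ne']⟩
  have hinv : 1 < valuation F (ϖ : F)⁻¹ := by
    rw [map_inv₀]; exact (one_lt_inv₀ hpos).2 hlt
  have hψα : valuation F (α : F) ≤ 1 → ψ (-(2 * θ * α)) = 1 := fun h => hψ _ (by
    rwa [Valuation.map_neg, map_mul, map_mul, h2, hθ, one_mul, one_mul])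
  have hc : valuation F (2 * θ * (α : F) ^ 2) ≤ valuation F (ϖ : F) ^ 2 * valuation F (b : F) ^ 2 := by
    rw [map_mul, map_mul, h2, hθ, one_mul, one_mul, map_pow, ← mul_pow]
    gcongr
  rcases lt_trichotomy (valuation F (b : F)) 1 with h | h | h
  · rw [Set.indicator_of_notMem (hm1.not.2 h.ne),
      Set.indicator_of_notMem (hm2.not.2 (h.trans hinv).ne), orbInt,
      orbInt_integrand_eq_zero h2 hϖ hθ hb h]
    simp
  · have hα1 : valuation F (α : F) ≤ 1 := hvα'.trans (by rw [h, mul_one]; exact hlt.le)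
    rw [Set.indicator_of_mem (hm1.2 h), Set.indicator_of_notMem (hm2.not.2 (h.trans_lt hinv).ne),
      orbInt_eq μ h2 hϖ hθ hb h.ge, hψα hα1, integral_region_one μ hψ hμ h2 h hα1 hθ]
    simp
  · have hble : valuation F (ϖ : F)⁻¹ ≤ valuation F (b : F) := by
      have := hϖ.le_mul_of_lt (x := 1) (y := (b : F)) (by simpa using h)
      rw [map_inv₀, inv_le_iff_one_le_mul₀ hpos, mul_comm]
      simpa using this
    have hαb : valuation F (α : F) ≤ valuation F (b : F) :=
      hvα'.trans (mul_le_of_le_one_left' hlt.le)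
    rw [Set.indicator_of_notMem (hm1.not.2 h.ne'), orbInt_eq μ h2 hϖ hθ hb h.le]
    rcases hble.lt_or_eq with hb' | hb'
    · rw [Set.indicator_of_notMem (hm2.not.2 hb'.ne'),
        integral_region_eq μ hψ hμ h2 hϖ hψ' h hαb hθ 0 fun z hz =>
          integral_sphere_eq_zero μ hψ hϖ hψ' hb' (valuation_two_mul_sub hchar hθ hθ' hz) hc]
      simp
    · have hα1 : valuation F (α : F) ≤ 1 := by
        rwa [← hb', map_inv₀, mul_inv_cancel₀ hpos.ne'] at hvα'
      rw [Set.indicator_of_mem (hm2.2 hb'.symm),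
        integral_region_eq μ hψ hμ h2 hϖ hψ' h hαb hθ (-1) fun z hz =>
          integral_sphere_eq_neg_one μ hψ hμ hϖ hψ' hb'.symm
            (valuation_two_mul_sub hchar hθ hθ' hz) hc, hψα hα1, ← hb', measureReal_def,
        measure_setOf_valuation_le_inv μ hμ hϖ]
      simp

end Integral

/-! ### Mellin transform over cosets of R^× -/

section Mellin

variable {F : Type*} [Field F] [ValuativeRel F] [TopologicalSpace F]
  [IsNonarchimedeanLocalField F]

attribute [local instance] t2Space secondCountableTopology

/-- F^× is closed in F × F through α ↦ (α, α⁻¹), and bounding both components by |g| and |g⁻¹|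
forces |α| = |g|. -/
theorem isCompact_setOf_units_valuation_eq (g : Fˣ) :
    IsCompact {α : Fˣ | valuation F (α : F) = valuation F (g : F)} := by
  have h := (isCompact_setOf_valuation_le (g : F)).prod
    (MulOpposite.opHomeomorph.symm.isCompact_preimage.2
      (isCompact_setOf_valuation_le ((g⁻¹ : Fˣ) : F)))
  convert Units.isClosedEmbedding_embedProduct.isCompact_preimage h using 1
  ext α
  have hα : 0 < valuation F (α : F) := zero_lt_iff.2 (by simp)
  have hg : 0 < valuation F (g : F) := zero_lt_iff.2 (by simp)
  simp [Units.embedProduct, le_antisymm_iff, inv_le_inv₀ hα hg]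

variable [MeasurableSpace F] [BorelSpace F]

theorem borelSpace_units : BorelSpace Fˣ := by
  refine ⟨?_⟩
  change MeasurableSpace.comap Units.val _ = _
  rw [(Units.isEmbedding_val₀ (G₀ := F)).eq_induced, borel_comap,
    BorelSpace.measurable_eq (α := F)]

theorem measurableSet_setOf_units_valuation_eq (g : Fˣ) :
    MeasurableSet {α : Fˣ | valuation F (α : F) = valuation F (g : F)} :=
  ⟨_, (isClopen_setOf_valuation_eq g.ne_zero).1.measurableSet, rfl⟩

variable (ν : Measure Fˣ) [ν.IsHaarMeasure] (χ : Fˣ →* ℂˣ)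

theorem integrable_indicator_char (hχ : Continuous χ) (g : Fˣ) :
    Integrable ({α : Fˣ | valuation F (α : F) = valuation F (g : F)}.indicator
      fun α => (χ α : ℂ)) ν := by
  have := borelSpace_units (F := F)
  rw [integrable_indicator_iff (measurableSet_setOf_units_valuation_eq g)]
  exact ContinuousOn.integrableOn_compact (isCompact_setOf_units_valuation_eq g)
    (Units.continuous_val.comp hχ).continuousOn

/-- Used in two ways: with h = 1 it reduces a coset to R^×, and with g a unit it compares a coset
with itself, forcing the integral to vanish when χ(g) ≠ 1. -/
theorem integral_indicator_char_mul (g h : Fˣ) :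
    ∫ α, {α : Fˣ | valuation F (α : F) = valuation F ((g * h : Fˣ) : F)}.indicator
      (fun α => (χ α : ℂ)) α ∂ν = χ g *
    ∫ α, {α : Fˣ | valuation F (α : F) = valuation F (h : F)}.indicator
      (fun α => (χ α : ℂ)) α ∂ν := by
  have := borelSpace_units (F := F)
  rw [← integral_mul_left_eq_self _ g, ← integral_const_mul]
  congr 1 with α
  have hg : valuation F (g : F) ≠ 0 := by simp
  classical
  simp [Set.indicator_apply, hg]

theorem integral_indicator_char_of_isUnramified (hν : ν (integerUnits F) = 1)
    (hχ : IsUnramified χ) (g : Fˣ) :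
    ∫ α, {α : Fˣ | valuation F (α : F) = valuation F (g : F)}.indicator
      (fun α => (χ α : ℂ)) α ∂ν = χ g := by
  have hm : MeasurableSet (integerUnits F) := by
    simpa [integerUnits] using measurableSet_setOf_units_valuation_eq (1 : Fˣ)
  have h1 := integral_indicator_char_mul ν χ g 1
  rw [mul_one] at h1
  rw [h1]
  have h2 : ({α : Fˣ | valuation F (α : F) = valuation F ((1 : Fˣ) : F)}.indicator
      fun α => (χ α : ℂ)) = (integerUnits F).indicator fun _ => 1 := by
    have h3 : {α : Fˣ | valuation F (α : F) = valuation F ((1 : Fˣ) : F)} = integerUnits F := by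
      simp [integerUnits]
    rw [h3]
    refine Set.indicator_congr fun α hα => ?_
    rw [hχ α hα, Units.val_one]
  rw [h2, integral_indicator_const _ hm]
  simp [measureReal_def, hν]

theorem integral_indicator_char_of_not_isUnramified (hχ : ¬ IsUnramified χ) (g : Fˣ) :
    ∫ α, {α : Fˣ | valuation F (α : F) = valuation F (g : F)}.indicator
      (fun α => (χ α : ℂ)) α ∂ν = 0 := by
  simp only [IsUnramified, not_forall] at hχ
  obtain ⟨u, hu, hχu⟩ := hχ
  have h := integral_indicator_char_mul ν χ u g
  have hug : valuation F ((u * g : Fˣ) : F) = valuation F (g : F) := by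
    rw [Units.val_mul, map_mul, show valuation F (u : F) = 1 from hu, one_mul]
  rw [hug] at h
  have h1 : (χ u : ℂ) ≠ 1 := fun h => hχu (Units.ext h)
  refine (mul_eq_zero.1 (?_ : ((χ u : ℂ) - 1) * _ = 0)).resolve_left (sub_ne_zero.2 h1)
  linear_combination -h

end Mellin

end SOFive

/-! ### The Mellin transform of Ψ -/

theorem proposition3p6 {F : Type*} [Field F] [ValuativeRel F] [TopologicalSpace F]
    [IsNonarchimedeanLocalField F] [MeasurableSpace F] [BorelSpace F]
    (hchar : ringChar 𝓀[F] ≠ 2)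
    (ϖ : Fˣ) (hϖ : SOFive.IsUniformizer ϖ)
    (ψ : AddChar F ℂ) (hψ : SOFive.HasConductorIntegers ψ ϖ)
    -- the additive measure `dx` and the multiplicative measure `d^×x`
    (μ : Measure F) [μ.IsAddHaarMeasure] (hμ : μ (𝒪[F] : Set F) = 1)
    (ν : Measure Fˣ) [ν.IsHaarMeasure] (hν : ν (SOFive.integerUnits F) = 1)
    (θ : F) (hθ : valuation F θ = 1) (hθ' : ¬ IsSquare θ)
    (r : ℕ) (hr : 1 ≤ r)
    (χ : Fˣ →* ℂˣ) (hχ : Continuous χ) :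
    (∀ α : Fˣ, Integrable (fun x : F × F × F =>
      SOFive.Φ ϖ θ r
        ((SOFive.nMat x.1 x.2.1 x.2.2 * SOFive.aMat α * SOFive.γ₀ F) *ᵥ SOFive.v₀ θ) *
        ψ (x.1 + 2 * θ * x.2.2)) (μ.prod (μ.prod μ))) ∧
    Integrable (fun α : Fˣ => SOFive.orbInt μ ψ θ (SOFive.Φ ϖ θ r) α * (χ α : ℂ)) ν ∧
    (SOFive.IsUnramified χ → ∀ X : ℂ, X = ((χ ϖ : ℂˣ) : ℂ)⁻¹ →
      ∫ α : Fˣ, SOFive.orbInt μ ψ θ (SOFive.Φ ϖ θ r) α * (χ α : ℂ) ∂ν =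
        X ^ (-(r : ℤ)) - (Nat.card 𝓀[F] : ℂ) * X ^ (1 - (r : ℤ))) ∧
    (¬ SOFive.IsUnramified χ →
      ∫ α : Fˣ, SOFive.orbInt μ ψ θ (SOFive.Φ ϖ θ r) α * (χ α : ℂ) ∂ν = 0) := by
  have hψ₁ : ∀ x : F, valuation F x ≤ 1 → ψ x = 1 := hψ.1
  have hψ₂ : ∃ x : F, valuation F x ≤ valuation F (ϖ : F)⁻¹ ∧ ψ x ≠ 1 := by
    obtain ⟨x, hx, hψx⟩ := hψ.2
    refine ⟨_, ?_, hψx⟩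
    rw [map_mul, Units.val_inv_eq_inv_val]
    exact mul_le_of_le_one_right' hx
  have hμ' : μ {x : F | valuation F x ≤ 1} = 1 := hμ
  have heq : (fun α : Fˣ => SOFive.orbInt μ ψ θ (SOFive.Φ ϖ θ r) α * (χ α : ℂ)) = fun α =>
      {α : Fˣ | valuation F (α : F) = valuation F ((ϖ ^ r : Fˣ) : F)}.indicator
        (fun α => (χ α : ℂ)) α - Nat.card 𝓀[F] *
      {α : Fˣ | valuation F (α : F) = valuation F ((ϖ ^ (r - 1) : Fˣ) : F)}.indicator
        (fun α => (χ α : ℂ)) α := by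
    ext α
    rw [SOFive.orbInt_Φ_eq μ hchar hψ₁ hμ' hϖ hψ₂ hθ hθ' hr]
    classical
    simp only [Set.indicator_apply, Pi.one_apply]
    split_ifs <;> ring
  have hi₁ := SOFive.integrable_indicator_char ν χ hχ (ϖ ^ r)
  have hi₂ := (SOFive.integrable_indicator_char ν χ hχ (ϖ ^ (r - 1))).const_mul
    (Nat.card 𝓀[F] : ℂ)
  refine ⟨SOFive.integrable_orbInt μ hψ₁ (SOFive.valuation_two hchar) hϖ hθ, ?_, ?_, ?_⟩
  · rw [heq]
    exact hi₁.sub hi₂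
  · rintro hun X rfl
    rw [heq, integral_sub hi₁ hi₂, integral_const_mul,
      SOFive.integral_indicator_char_of_isUnramified ν χ hν hun,
      SOFive.integral_indicator_char_of_isUnramified ν χ hν hun]
    obtain ⟨s, rfl⟩ : ∃ s, r = s + 1 := ⟨r - 1, by omega⟩
    have h1 : (1 : ℤ) - ((s + 1 : ℕ) : ℤ) = -(s : ℤ) := by push_cast; ring
    rw [h1, zpow_neg, zpow_neg, zpow_natCast, zpow_natCast, inv_pow, inv_pow, inv_inv, inv_inv]
    simp
  · intro hram
    rw [heq, integral_sub hi₁ hi₂, integral_const_mul,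
      SOFive.integral_indicator_char_of_not_isUnramified ν χ hram,
      SOFive.integral_indicator_char_of_not_isUnramified ν χ hram]
    simp
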